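/- A finite hypergraph $H=(X,E)$ consists of a finite vertex set $X$ and a finite collection $E$ of subsets of $X$, called hyperedges (repeated hyperedges and twin vertices are allowed). A set $C\subseteq X$ induces on $E$ the equivalence relation $e\sim e' \iff e\cap C=e'\cap C$; the number of equivalence classes that $C$ induces is thus $|\{e\cap C : e\in E\}|$. The problem \textsc{Partial VC Dimension} asks, given a finite hypergraph $H=(X,E)$ and two integers $k,\ell\ge 0$, whether there is a set $C\subseteq X$ of size exactly $k$ that induces at least $\ell$ equivalence classes. A parameterized problem belongs to the class XP if there are a computable function $f:\mathbb{N}\to\mathbb{N}$ and a single deterministic Turing machine that correctly decides every instance $I$ with parameter $p$ in time at most $|I|^{f(p)}$, where $|I|$ is the length of the encoding of $I$. **Proposition.** \textsc{Partial VC Dimension} parameterized by $|E|-k$ (read as $0$ if $k>|E|$) belongs to XP. Here an instance is encoded by writing $k$ and $\ell$ in binary, the vertex set in unary, and the hyperedges as the rows of the incidence matrix, and the Turing machine may have several stacks (tapes). -/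

import Mathlib

/-- A finite hypergraph `(X, E)`: the vertex set is `X = Fin numVertices`, and `E` is a collection
of `numEdges` subsets of `X`. As in a concrete input, vertices and hyperedges are numbered; equal
hyperedges and twin vertices are allowed, which Mathlib's set-based `Hypergraph α` excludes for
hyperedges. -/
structure FinHypergraph where
  numVertices : ℕ
  numEdges : ℕ
  edge : Fin numEdges → Finset (Fin numVertices)

namespace FinHypergraph

/-- The number of equivalence classes that `C` induces on the hyperedges, i.e. the number of
distinct intersections `e ∩ C` with `e ∈ E`. -/
def numClasses (H : FinHypergraph) (C : Finset (Fin H.numVertices)) : ℕ :=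
  (Finset.univ.image fun i => H.edge i ∩ C).card

/-- The row of a hyperedge in the incidence matrix. -/
def row (H : FinHypergraph) (i : Fin H.numEdges) : List Bool :=
  List.ofFn fun x : Fin H.numVertices => decide (x ∈ H.edge i)

end FinHypergraph

/-- An instance of Partial VC Dimension: a hypergraph and two integers. -/
structure PartialVCInstance where
  H : FinHypergraph
  k : ℕ
  l : ℕ

/-- The question of Partial VC Dimension: is there a set of exactly `k` vertices that induces at
least `l` equivalence classes? -/
def PartialVCInstance.IsYes (I : PartialVCInstance) : Prop :=
  ∃ C : Finset (Fin I.H.numVertices), C.card = I.k ∧ I.l ≤ I.H.numClasses C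

/-- Concatenation of binary words over the alphabet `{0, 1, #}`, where `some b` is the bit `b` and
`none` is the end marker `#` that closes every word. -/
def encodeWords (ws : List (List Bool)) : List (Option Bool) :=
  ws.flatMap fun w => w.map some ++ [none]

theorem encodeWords_injective : Function.Injective encodeWords := by
  have key : ∀ (a b : List Bool) (u v : List (Option Bool)),
      a.map some ++ none :: u = b.map some ++ none :: v → a = b ∧ u = v := by
    intro a
    induction a with
    | nil =>
      intro b u v h
      cases b with
      | nil => simpa using h
      | cons y b => simp at h
    | cons x a ih =>
      intro b u v h
      cases b with
      | nil => simp at h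
      | cons y b =>
        simp only [List.map_cons, List.cons_append, List.cons.injEq, Option.some.injEq] at h
        obtain ⟨h1, h2⟩ := ih b u v h.2
        exact ⟨by rw [h.1, h1], h2⟩
  intro ws
  induction ws with
  | nil =>
    intro vs h
    cases vs with
    | nil => rfl
    | cons v vs => simp [encodeWords] at h
  | cons w ws ih =>
    intro vs h
    cases vs with
    | nil => simp [encodeWords] at h
    | cons v vs =>
      simp only [encodeWords, List.flatMap_cons, List.append_assoc, List.singleton_append] at h
      obtain ⟨h1, h2⟩ := key w v _ _ h
      rw [h1, ih h2]

/-- The standard encoding of an instance: the integers `k` and `l` in binary (least significant bit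
first), the number of vertices in unary, and the incidence matrix, one row for each hyperedge. -/
def PartialVCInstance.encode (I : PartialVCInstance) : List (Option Bool) :=
  encodeWords
    (I.k.bits :: I.l.bits :: List.replicate I.H.numVertices true ::
      (List.finRange I.H.numEdges).map I.H.row)

theorem PartialVCInstance.encode_injective : Function.Injective PartialVCInstance.encode := by
  have bits_inj : ∀ a b : ℕ, a.bits = b.bits → a = b := by
    intro a b h
    have h2 : Nat.digits 2 a = Nat.digits 2 b := by
      rw [Nat.digits_two_eq_bits, Nat.digits_two_eq_bits, h]
    exact Nat.digits_inj_iff.mp h2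
  rintro ⟨⟨n, m, e⟩, k, l⟩ ⟨⟨n', m', e'⟩, k', l'⟩ h
  have h' := encodeWords_injective h
  simp only [List.cons.injEq] at h'
  obtain ⟨hk, hl, hn, hE⟩ := h'
  obtain rfl := bits_inj _ _ hk
  obtain rfl := bits_inj _ _ hl
  obtain rfl : n = n' := by simpa using congrArg List.length hn
  obtain rfl : m = m' := by simpa using congrArg List.length hE
  have he : e = e' := by
    funext i
    have hi := List.map_inj_left.mp hE i (List.mem_finRange i)
    ext x
    have hx := congrFun (List.ofFn_injective hi) x
    simpa using hx
  rw [he]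

/-- A parameterized problem: a decision problem whose instances are words over a finite alphabet,
together with a parameter, a number that depends on the instance. -/
structure ParameterizedProblem where
  Instance : Type
  Symbol : Type
  finite_symbol : Finite Symbol
  encode : Instance → List Symbol
  encode_injective : Function.Injective encode
  IsYes : Instance → Prop
  param : Instance → ℕ

open Classical in
/-- The class XP: there are a computable function `f` and one deterministic (multi-stack) Turing
machine that, on every instance `I` with parameter `p`, halts after at most `|I| ^ f p` steps with
the correct answer as its output, where `|I|` is the length of the encoding of `I`.
(`Turing.FinTM2` itself only says that the input stack has a finite alphabet; here all stacks
have.) -/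
def ParameterizedProblem.InXP (P : ParameterizedProblem) : Prop :=
  ∃ (f : ℕ → ℕ) (M : Turing.TM2ComputableAux P.Symbol Bool),
    Computable f ∧ (∀ s, Finite (M.tm.Γ s)) ∧
    ∀ I : P.Instance, Nonempty (Turing.TM2OutputsInTime M.tm
      ((P.encode I).map M.inputAlphabet.symm)
      (some [M.outputAlphabet.symm (decide (P.IsYes I))])
      ((P.encode I).length ^ f (P.param I)))

/-- Partial VC Dimension parameterized by `|E| - k`. The parameter is a natural number: by truncated
subtraction it is `0` when `k ≥ |E|`, so that the running time has to be polynomial in all these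
cases together. -/
def partialVCDimensionDual : ParameterizedProblem where
  Instance := PartialVCInstance
  Symbol := Option Bool
  finite_symbol := inferInstance
  encode := PartialVCInstance.encode
  encode_injective := PartialVCInstance.encode_injective
  IsYes := PartialVCInstance.IsYes
  param := fun I => I.H.numEdges - I.k

/-! Call the number of classes of `C` minus `|C| + 1` the excess of `C`. As long as `C` does not
induce all classes that the whole vertex set induces, some vertex splits a class, so a set can be
grown greedily without losing excess (`exists_card_eq_of_excess`). Hence for `l ≤ k + 1` only
trivial conditions on `k` and `l` matter. Otherwise an excess `j = l - k - 1` is needed, and `l ≤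
|E|` gives `j < |E| - k`.

The combinatorial core is `exists_small_excess`: excess `j` is already attained by a subset of at
most `2 * j` vertices. A vertex that splits `d + 1` classes gains excess `d`, and to reproduce this
gain it is enough to separate representatives of these classes, with at most `d` vertices that each
add a class. So `d ≥ 1` units of excess cost at most `d + 1 ≤ 2 * d` vertices. Therefore it suffices
to try all sets of up to `min k (2 * (|E| - k))` vertices and to credit one class for every vertex
still to be added (`isYes_iff`).

With parameter `p` these are at most `n ^ (2 * p)` candidates, each tested in polynomial time. The
rest implements this search on stacks: `Runs` is a compositional correctness and time statement for
program fragments, `runs_partialVC` assembles the procedure, `accepts_iff` relates its test to the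
problem, and `partialVCTime_lt` bounds the time by `z ^ (4 * p + 9)`. -/

namespace FinHypergraph

/-! ### Traces of hyperedges and greedy growth of vertex sets. -/

variable (H : FinHypergraph)

/-- The intersection of the `i`-th hyperedge with `C`. -/
def trace (C : Finset (Fin H.numVertices)) (i : Fin H.numEdges) : Finset (Fin H.numVertices) :=
  H.edge i ∩ C

theorem numClasses_eq (C : Finset (Fin H.numVertices)) :
    H.numClasses C = (Finset.univ.image (H.trace C)).card := rfl

variable {H}

theorem trace_eq_iff {C : Finset (Fin H.numVertices)} {i j : Fin H.numEdges} :
    H.trace C i = H.trace C j ↔ ∀ x ∈ C, (x ∈ H.edge i ↔ x ∈ H.edge j) := by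
  simp only [trace, Finset.ext_iff, Finset.mem_inter]
  exact ⟨fun h x hx => by simpa [hx] using h x, fun h x => by
    by_cases hx : x ∈ C <;> simp [hx]; exact h x hx⟩

theorem trace_eq_mono {C D : Finset (Fin H.numVertices)} (h : D ⊆ C) {i j : Fin H.numEdges}
    (hij : H.trace C i = H.trace C j) : H.trace D i = H.trace D j :=
  trace_eq_iff.2 fun x hx => trace_eq_iff.1 hij x (h hx)

theorem image_trace_inter {C D : Finset (Fin H.numVertices)} (h : D ⊆ C)
    (R : Finset (Fin H.numEdges)) :
    R.image (H.trace D) = (R.image (H.trace C)).image (· ∩ D) := by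
  rw [Finset.image_image]
  refine Finset.image_congr fun i _ => ?_
  simp [trace, Finset.inter_assoc, Finset.inter_eq_right.2 h]

theorem card_image_trace_mono {C D : Finset (Fin H.numVertices)} (h : D ⊆ C)
    (R : Finset (Fin H.numEdges)) :
    (R.image (H.trace D)).card ≤ (R.image (H.trace C)).card := by
  rw [image_trace_inter h]
  exact Finset.card_image_le

/-- Intersecting with `D` maps the traces on `C` onto those on `D`. Equal cardinalities would make
this map injective, but it merges the traces of `i` and `j`. -/
theorem card_image_trace_lt {C D : Finset (Fin H.numVertices)} (h : D ⊆ C)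
    {R : Finset (Fin H.numEdges)} {i j : Fin H.numEdges} (hi : i ∈ R) (hj : j ∈ R)
    (hD : H.trace D i = H.trace D j) (hC : H.trace C i ≠ H.trace C j) :
    (R.image (H.trace D)).card < (R.image (H.trace C)).card := by
  refine lt_of_le_of_ne (card_image_trace_mono h R) fun he => hC ?_
  rw [image_trace_inter h] at he
  have := Finset.card_image_iff.1 he
  refine this (by simpa using ⟨i, hi, rfl⟩) (by simpa using ⟨j, hj, rfl⟩) ?_
  simpa [trace, Finset.inter_assoc, Finset.inter_eq_right.2 h] using hD

theorem numClasses_mono {C D : Finset (Fin H.numVertices)} (h : D ⊆ C) :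
    H.numClasses D ≤ H.numClasses C :=
  card_image_trace_mono h _

theorem numClasses_le (C : Finset (Fin H.numVertices)) : H.numClasses C ≤ H.numEdges :=
  Finset.card_image_le.trans (by simp)

/-- If no single vertex split a class of `D`, hyperedges with equal traces on `D` would agree on
every vertex, and `D` would already induce all classes. -/
theorem exists_lt_numClasses_insert {D : Finset (Fin H.numVertices)}
    (h : H.numClasses D < H.numClasses Finset.univ) :
    ∃ x, x ∉ D ∧ H.numClasses D < H.numClasses (insert x D) := by
  by_contra! hc
  refine absurd h (not_lt.2 ?_)
  have key : ∀ i j, H.trace D i = H.trace D j → H.trace Finset.univ i = H.trace Finset.univ j := by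
    intro i j hij
    refine trace_eq_iff.2 fun x _ => ?_
    by_cases hx : x ∈ D
    · exact trace_eq_iff.1 hij x hx
    · by_contra hne
      refine absurd (hc x hx) (not_le.2 ?_)
      refine card_image_trace_lt (Finset.subset_insert x D) (Finset.mem_univ i)
        (Finset.mem_univ j) hij fun he => hne ?_
      exact trace_eq_iff.1 he x (Finset.mem_insert_self x D)
  rw [numClasses_eq, numClasses_eq, image_trace_inter (Finset.subset_univ D)]
  refine (Finset.card_image_iff.2 ?_).ge
  intro a ha b hb hab
  obtain ⟨i, -, rfl⟩ := Finset.mem_image.1 (Finset.mem_coe.1 ha)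
  obtain ⟨j, -, rfl⟩ := Finset.mem_image.1 (Finset.mem_coe.1 hb)
  refine key i j ?_
  simpa [trace] using hab

/-- A set with enough classes for its size can be enlarged to any size, since every further vertex
can be chosen so as to add a class, as long as some class is still to be split. -/
theorem exists_card_eq_of_excess {k l : ℕ} (hk : k ≤ H.numVertices)
    (hl : l ≤ H.numClasses Finset.univ) (d : ℕ) :
    ∀ D : Finset (Fin H.numVertices), D.card + d = k → l ≤ H.numClasses D + d →
      ∃ C, D ⊆ C ∧ C.card = k ∧ l ≤ H.numClasses C := by
  induction d with
  | zero => exact fun D h1 h2 => ⟨D, subset_rfl, h1, h2⟩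
  | succ d ih =>
    intro D h1 h2
    have step : ∃ x, x ∉ D ∧ l ≤ H.numClasses (insert x D) + d := by
      by_cases h : H.numClasses D < H.numClasses Finset.univ
      · obtain ⟨x, hx, hlt⟩ := exists_lt_numClasses_insert h
        exact ⟨x, hx, by omega⟩
      -- No class is left to split, so `D` already has at least `l` classes and any new vertex will
      -- do.
      · have : ∃ x, x ∉ D := by
          by_contra! hc
          have : D = Finset.univ := Finset.eq_univ_iff_forall.2 hc
          rw [this, Finset.card_univ, Fintype.card_fin] at h1
          omega
        obtain ⟨x, hx⟩ := this
        have := numClasses_mono (H := H) (Finset.subset_insert x D)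
        exact ⟨x, hx, by omega⟩
    obtain ⟨x, hx, hlx⟩ := step
    obtain ⟨C, hC, h⟩ := ih (insert x D) (by rw [Finset.card_insert_of_notMem hx]; omega) hlx
    exact ⟨C, (Finset.subset_insert x D).trans hC, h⟩

/-- While two hyperedges of `R` share a trace on `D`, some vertex of `C` tells them apart. Adding it
increases the number of traces of `R`, which bounds the number of additions, and also the total
number of classes, so no excess is lost. The induction runs over a bound `e` on the number of
missing traces. -/
theorem exists_separating {C : Finset (Fin H.numVertices)} {R : Finset (Fin H.numEdges)}
    (hR : Set.InjOn (H.trace C) R) (e : ℕ) :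
    ∀ D ⊆ C, R.card ≤ (R.image (H.trace D)).card + e →
      ∃ D', D ⊆ D' ∧ D' ⊆ C ∧ Set.InjOn (H.trace D') R ∧
        D'.card + (R.image (H.trace D)).card ≤ D.card + R.card ∧
        H.numClasses D + D'.card ≤ H.numClasses D' + D.card := by
  induction e with
  | zero =>
    intro D hD h
    have := Finset.card_image_le (s := R) (f := H.trace D)
    exact ⟨D, subset_rfl, hD, Finset.card_image_iff.1 (by omega), by omega, le_rfl⟩
  | succ e ih =>
    intro D hD h
    by_cases hinj : Set.InjOn (H.trace D) R
    · exact ⟨D, subset_rfl, hD, hinj, by rw [Finset.card_image_iff.2 hinj], le_rfl⟩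
    · simp only [Set.InjOn, not_forall] at hinj
      obtain ⟨i, hi, j, hj, hij, hne⟩ := hinj
      have hCne : H.trace C i ≠ H.trace C j := fun hc => hne (hR hi hj hc)
      obtain ⟨x, hxC, hx⟩ : ∃ x ∈ C, ¬(x ∈ H.edge i ↔ x ∈ H.edge j) := by
        by_contra! hc
        exact hCne (trace_eq_iff.2 hc)
      have hxD : x ∉ D := fun hxD => hx (trace_eq_iff.1 hij x hxD)
      have hsep : H.trace (insert x D) i ≠ H.trace (insert x D) j := fun hc =>
        hx (trace_eq_iff.1 hc x (Finset.mem_insert_self x D))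
      have h1 := card_image_trace_lt (Finset.subset_insert x D) hi hj hij hsep
      have h2 : H.numClasses D < H.numClasses (insert x D) :=
        card_image_trace_lt (Finset.subset_insert x D) (Finset.mem_univ i) (Finset.mem_univ j)
          hij hsep
      obtain ⟨D', g1, g2, g3, g4, g5⟩ := ih (insert x D)
        (Finset.insert_subset hxC hD) (by omega)
      rw [Finset.card_insert_of_notMem hxD] at g4 g5
      exact ⟨D', (Finset.subset_insert x D).trans g1, g2, g3, by omega, by omega⟩

/-! ### Split classes and small sets of given excess. -/

/-- The classes of `C` that are split by `x`. -/
def splitBy (C : Finset (Fin H.numVertices)) (x : Fin H.numVertices) :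
    Finset (Finset (Fin H.numVertices)) :=
  (Finset.univ.filter (x ∈ H.edge ·)).image (H.trace C) ∩
    (Finset.univ.filter (x ∉ H.edge ·)).image (H.trace C)

/-- The vertex `x` separates the hyperedges containing it from the others and is irrelevant inside
either group. So the new count is the sum of the two trace counts on `C`, which exceeds that of the
union by the size of the intersection. -/
theorem numClasses_insert {C : Finset (Fin H.numVertices)} {x : Fin H.numVertices} (hx : x ∉ C) :
    H.numClasses (insert x C) = H.numClasses C + (splitBy C x).card := by
  have hin : ∀ R : Finset (Fin H.numEdges), (∀ i ∈ R, ∀ j ∈ R, (x ∈ H.edge i ↔ x ∈ H.edge j)) →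
      (R.image (H.trace (insert x C))).card = (R.image (H.trace C)).card := by
    intro R hR
    rw [image_trace_inter (Finset.subset_insert x C)]
    refine (Finset.card_image_iff.2 ?_).symm
    intro a ha b hb hab
    obtain ⟨i, hi, rfl⟩ := Finset.mem_image.1 (Finset.mem_coe.1 ha)
    obtain ⟨j, hj, rfl⟩ := Finset.mem_image.1 (Finset.mem_coe.1 hb)
    have hab' : H.trace C i = H.trace C j := by
      simpa [trace, Finset.inter_assoc,
        Finset.inter_eq_right.2 (Finset.subset_insert x C)] using hab
    refine trace_eq_iff.2 fun y hy => ?_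
    rcases Finset.mem_insert.1 hy with rfl | hy
    · exact hR i hi j hj
    · exact trace_eq_iff.1 hab' y hy
  have hsplit : ∀ D, H.numClasses D = ((Finset.univ.filter (x ∈ H.edge ·)).image (H.trace D) ∪
      (Finset.univ.filter (x ∉ H.edge ·)).image (H.trace D)).card := by
    intro D
    rw [← Finset.image_union, Finset.filter_union_filter_not_eq, numClasses_eq]
  have h1 := hin (Finset.univ.filter (x ∈ H.edge ·)) (by simp +contextual)
  have h2 := hin (Finset.univ.filter (x ∉ H.edge ·)) (by simp +contextual)
  have h3 : Disjoint ((Finset.univ.filter (x ∈ H.edge ·)).image (H.trace (insert x C)))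
      ((Finset.univ.filter (x ∉ H.edge ·)).image (H.trace (insert x C))) := by
    rw [Finset.disjoint_left]
    intro a ha hb
    obtain ⟨i, hi, rfl⟩ := Finset.mem_image.1 ha
    obtain ⟨j, hj, hij⟩ := Finset.mem_image.1 hb
    simp only [Finset.mem_filter, Finset.mem_univ, true_and] at hi hj
    exact hj ((trace_eq_iff.1 hij x (Finset.mem_insert_self x C)).2 hi)
  rw [hsplit, Finset.card_union_of_disjoint h3, h1, h2, hsplit, splitBy,
    Finset.card_union_add_card_inter]

/-- If `C` has `j` classes more than the `|C| + 1` that are always available, then so has a subset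
of size at most `2 * j`. -/
theorem exists_small_excess (hm : 0 < H.numEdges) (C : Finset (Fin H.numVertices)) :
    ∀ j, C.card + 1 + j ≤ H.numClasses C →
      ∃ D ⊆ C, D.card ≤ 2 * j ∧ D.card + 1 + j ≤ H.numClasses D := by
  induction C using Finset.induction_on with
  | empty => exact fun j h => ⟨∅, subset_rfl, by simp, h⟩
  | insert x C hx ih =>
    intro j h
    rw [Finset.card_insert_of_notMem hx, numClasses_insert hx] at h
    -- A vertex that splits at most one class brings no excess, so `C` without it still has excess
    -- `j`.
    rcases Nat.lt_or_ge (splitBy C x).card 2 with hs | hs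
    · obtain ⟨D, h1, h2⟩ := ih j (by omega)
      exact ⟨D, h1.trans (Finset.subset_insert x C), h2⟩
    rcases Nat.eq_zero_or_pos j with rfl | hj
    · refine ⟨∅, by simp, by simp, ?_⟩
      have : (⟨0, hm⟩ : Fin H.numEdges) ∈ (Finset.univ : Finset (Fin H.numEdges)) :=
        Finset.mem_univ _
      have := Finset.card_pos.2 ⟨_, Finset.mem_image_of_mem (H.trace ∅) this⟩
      rw [numClasses_eq]
      simpa using this
    -- `d` is the excess that `x` will supply: as much as is needed, and at most the number of split
    -- classes minus one.
    obtain ⟨d, hd1, hdj, hds, hd⟩ : ∃ d, 1 ≤ d ∧ d ≤ j ∧ d + 1 ≤ (splitBy C x).card ∧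
        (d = j ∨ d + 1 = (splitBy C x).card) := by
      rcases le_total j ((splitBy C x).card - 1) with h | h
      · exact ⟨j, by omega, by omega, by omega, by omega⟩
      · exact ⟨(splitBy C x).card - 1, by omega, by omega, by omega, by omega⟩
    -- If `x` supplies everything, the empty set with its single class is a start; otherwise `C` has
    -- the remaining excess `j - d` and the induction hypothesis applies.
    obtain ⟨D₀, hD₀, hc₀, he₀⟩ : ∃ D ⊆ C, D.card ≤ 2 * (j - d) ∧
        D.card + 1 + (j - d) ≤ H.numClasses D := by
      rcases hd with rfl | hd
      · refine ⟨∅, by simp, by simp, ?_⟩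
        have : (⟨0, hm⟩ : Fin H.numEdges) ∈ (Finset.univ : Finset (Fin H.numEdges)) :=
          Finset.mem_univ _
        have := Finset.card_pos.2 ⟨_, Finset.mem_image_of_mem (H.trace ∅) this⟩
        rw [numClasses_eq]
        simpa using this
      · exact ih (j - d) (by omega)
    obtain ⟨S, hS, hSc⟩ := Finset.exists_subset_card_eq hds
    have hrep : ∀ a ∈ S, ∃ i, H.trace C i = a ∧ x ∈ H.edge i ∧
        ∃ i', H.trace C i' = a ∧ x ∉ H.edge i' := by
      intro a ha
      have := hS ha
      simp only [splitBy, Finset.mem_inter, Finset.mem_image, Finset.mem_filter,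
        Finset.mem_univ, true_and] at this
      obtain ⟨⟨i, hi, rfl⟩, ⟨i', hi', h'⟩⟩ := this
      exact ⟨i, rfl, hi, i', h', hi'⟩
    have : Nonempty (Fin H.numEdges) := ⟨⟨0, hm⟩⟩
    choose! rep hrep hxrep rep' hrep' hxrep' using hrep
    have hRinj : Set.InjOn rep S := fun a ha b hb hab => by
      rw [← hrep a ha, ← hrep b hb, hab]
    have hRc : (S.image rep).card = d + 1 := by rw [Finset.card_image_iff.2 hRinj, hSc]
    have hinj : Set.InjOn (H.trace C) (S.image rep : Finset _) := by
      intro i hi i' hi' hii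
      obtain ⟨a, ha, rfl⟩ := Finset.mem_image.1 (Finset.mem_coe.1 hi)
      obtain ⟨b, hb, rfl⟩ := Finset.mem_image.1 (Finset.mem_coe.1 hi')
      rw [hrep a ha, hrep b hb] at hii
      rw [hii]
    -- The `d + 1` representatives have at least one trace on `D₀`, so separating them costs at most
    -- `d` vertices.
    obtain ⟨D', g1, g2, g3, g4, g5⟩ := exists_separating hinj _ D₀ hD₀ (Nat.le_add_left _ _)
    have hpos : 0 < ((S.image rep).image (H.trace D₀)).card :=
      Finset.card_pos.2 (Finset.Nonempty.image (Finset.card_pos.1 (by omega)) _)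
    have hxD' : x ∉ D' := fun h => hx (g2 h)
    -- The two representatives of a split class of `C`, with and without `x`, have the same trace on
    -- `D' ⊆ C`, so `x` still splits all these classes.
    have hsplit : d + 1 ≤ (splitBy D' x).card := by
      rw [← hRc, ← Finset.card_image_iff.2 g3]
      refine Finset.card_le_card fun b hb => ?_
      simp only [Finset.mem_image, exists_exists_and_eq_and] at hb
      obtain ⟨a, ha, rfl⟩ := hb
      simp only [splitBy, Finset.mem_inter, Finset.mem_image, Finset.mem_filter,
        Finset.mem_univ, true_and]
      exact ⟨⟨_, hxrep a ha, rfl⟩, _, hxrep' a ha,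
        trace_eq_mono g2 ((hrep' a ha).trans (hrep a ha).symm)⟩
    refine ⟨insert x D', Finset.insert_subset_insert x g2, ?_, ?_⟩
    -- The size is at most `2 * (j - d) + d + 1`, which is at most `2 * j` because `d ≥ 1`.
    · rw [Finset.card_insert_of_notMem hxD']; omega
    · rw [Finset.card_insert_of_notMem hxD', numClasses_insert hxD']; omega

theorem numClasses_empty (hm : 0 < H.numEdges) : H.numClasses ∅ = 1 := by
  have : H.trace ∅ = fun _ => ∅ := by funext i; simp [trace]
  rw [numClasses_eq, this, Finset.image_const ⟨⟨0, hm⟩, Finset.mem_univ _⟩, Finset.card_singleton]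

end FinHypergraph

/-- A set of `k` vertices with at least `l` classes exists if and only if there is one of size
`r = min k (2 * (|E| - k))` that misses only those classes that `k - r` further vertices are bound
to add. -/
theorem PartialVCInstance.isYes_iff (I : PartialVCInstance) :
    I.IsYes ↔ I.k ≤ I.H.numVertices ∧ I.l ≤ I.H.numClasses Finset.univ ∧
      ∃ D : Finset (Fin I.H.numVertices), D.card = min I.k (2 * (I.H.numEdges - I.k)) ∧
        I.l ≤ I.H.numClasses D + (I.k - min I.k (2 * (I.H.numEdges - I.k))) := by
  constructor
  · rintro ⟨C, hC, hl⟩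
    have hk : I.k ≤ I.H.numVertices := by
      rw [← hC]; simpa using Finset.card_le_univ C
    have hlu := hl.trans (FinHypergraph.numClasses_mono (Finset.subset_univ C))
    have hle := FinHypergraph.numClasses_le C
    refine ⟨hk, hlu, ?_⟩
    obtain ⟨D, hD, hDl⟩ : ∃ D : Finset (Fin I.H.numVertices),
        D.card ≤ min I.k (2 * (I.H.numEdges - I.k)) ∧
        I.l ≤ I.H.numClasses D + (I.k - D.card) := by
      -- In the first case `l ≤ |E|` bounds the excess by `|E| - k - 1`. In the second the empty set
      -- suffices; without hyperedges it has no class, but then `l = 0`.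
      rcases Nat.lt_or_ge (I.k + 1) I.l with h | h
      · obtain ⟨D, hDC, h1, h2⟩ := FinHypergraph.exists_small_excess (by omega) C
          (I.l - I.k - 1) (by omega)
        have := Finset.card_le_card hDC
        exact ⟨D, le_min (by omega) (by omega), by omega⟩
      · refine ⟨∅, by simp, ?_⟩
        rcases Nat.eq_zero_or_pos I.H.numEdges with hm | hm
        · simp; omega
        · rw [FinHypergraph.numClasses_empty hm]; simp; omega
    -- Padding to exactly `r` vertices keeps the excess; the target is lowered by the `k - r`
    -- classes still to come.
    obtain ⟨D', -, h1, h2⟩ := FinHypergraph.exists_card_eq_of_excess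
      (k := min I.k (2 * (I.H.numEdges - I.k)))
      (l := min (I.l - (I.k - min I.k (2 * (I.H.numEdges - I.k)))) I.l) (by omega) (by omega)
      (min I.k (2 * (I.H.numEdges - I.k)) - D.card) D (by omega) (by omega)
    exact ⟨D', h1, by omega⟩
  · rintro ⟨hk, hl, D, hD, hDl⟩
    obtain ⟨C, -, h1, h2⟩ := FinHypergraph.exists_card_eq_of_excess hk hl
      (I.k - min I.k (2 * (I.H.numEdges - I.k))) D (by omega) hDl
    exact ⟨C, h1, h2⟩

/-- Soundness is needed for all sizes up to `r`, since the enumeration also produces smaller sets. A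
smaller `D` only leaves more vertices for the greedy growth. -/
theorem PartialVCInstance.isYes_of_small (I : PartialVCInstance) (hk : I.k ≤ I.H.numVertices)
    (hl : I.l ≤ I.H.numClasses Finset.univ) (D : Finset (Fin I.H.numVertices))
    (hD : D.card ≤ min I.k (2 * (I.H.numEdges - I.k)))
    (hDl : I.l ≤ I.H.numClasses D + (I.k - min I.k (2 * (I.H.numEdges - I.k)))) : I.IsYes := by
  obtain ⟨C, -, h1, h2⟩ := FinHypergraph.exists_card_eq_of_excess hk hl
    (I.k - D.card) D (by omega) (by omega)
  exact ⟨C, h1, h2⟩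

/-! ### Stacks, program fragments and their composition. -/

/-- The tape alphabet of all stacks but the output stack. -/
abbrev Cell := Option Bool

/-- The names of the working stacks. -/
inductive Reg
  | inp | tok | tmp | bits | una | cnt | lim | room | goal | goal2
  | mat | mat2 | pat | pat2 | mask | flag | sets | sets2 | pre | ans | bad
  deriving DecidableEq

instance : Fintype Reg where
  elems := {.inp, .tok, .tmp, .bits, .una, .cnt, .lim, .room, .goal, .goal2, .mat,
    .mat2, .pat, .pat2, .mask, .flag, .sets, .sets2, .pre, .ans, .bad}
  complete := fun r => by cases r <;> decide

/-- The contents of the working stacks. -/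

structure Store where
  inp : List Cell := []
  tok : List Cell := []
  tmp : List Cell := []
  bits : List Cell := []
  una : List Cell := []
  cnt : List Cell := []
  lim : List Cell := []
  room : List Cell := []
  goal : List Cell := []
  goal2 : List Cell := []
  mat : List Cell := []
  mat2 : List Cell := []
  pat : List Cell := []
  pat2 : List Cell := []
  mask : List Cell := []
  flag : List Cell := []
  sets : List Cell := []
  sets2 : List Cell := []
  pre : List Cell := []
  ans : List Cell := []
  bad : List Cell := []

namespace Store

/-- The content of a stack. -/
def get (s : Store) : Reg → List Cell
  | .inp => s.inp
  | .tok => s.tok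
  | .tmp => s.tmp
  | .bits => s.bits
  | .una => s.una
  | .cnt => s.cnt
  | .lim => s.lim
  | .room => s.room
  | .goal => s.goal
  | .goal2 => s.goal2
  | .mat => s.mat
  | .mat2 => s.mat2
  | .pat => s.pat
  | .pat2 => s.pat2
  | .mask => s.mask
  | .flag => s.flag
  | .sets => s.sets
  | .sets2 => s.sets2
  | .pre => s.pre
  | .ans => s.ans
  | .bad => s.bad

/-- Replace the content of a stack. -/
def set (s : Store) : Reg → List Cell → Store
  | .inp, y => { s with inp := y }
  | .tok, y => { s with tok := y }
  | .tmp, y => { s with tmp := y }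
  | .bits, y => { s with bits := y }
  | .una, y => { s with una := y }
  | .cnt, y => { s with cnt := y }
  | .lim, y => { s with lim := y }
  | .room, y => { s with room := y }
  | .goal, y => { s with goal := y }
  | .goal2, y => { s with goal2 := y }
  | .mat, y => { s with mat := y }
  | .mat2, y => { s with mat2 := y }
  | .pat, y => { s with pat := y }
  | .pat2, y => { s with pat2 := y }
  | .mask, y => { s with mask := y }
  | .flag, y => { s with flag := y }
  | .sets, y => { s with sets := y }
  | .sets2, y => { s with sets2 := y }
  | .pre, y => { s with pre := y }
  | .ans, y => { s with ans := y }
  | .bad, y => { s with bad := y }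

@[simp] theorem get_set_self (s : Store) (r : Reg) (y : List Cell) : (s.set r y).get r = y := by
  cases r <;> rfl

theorem get_set_of_ne (s : Store) {r r' : Reg} (h : r' ≠ r) (y : List Cell) :
    (s.set r y).get r' = s.get r' := by
  cases r <;> cases r' <;> first | rfl | exact absurd rfl h

@[simp] theorem set_get (s : Store) (r : Reg) : s.set r (s.get r) = s := by
  cases r <;> rfl

@[simp] theorem set_set (s : Store) (r : Reg) (y z : List Cell) :
    (s.set r y).set r z = s.set r z := by
  cases r <;> rfl

theorem set_comm (s : Store) {r r' : Reg} (h : r' ≠ r) (y z : List Cell) :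
    (s.set r y).set r' z = (s.set r' z).set r y := by
  cases r <;> cases r' <;> first | rfl | exact absurd rfl h

end Store

/-- The alphabets of the stacks; `none` is the output stack. -/
abbrev StackAlphabet : Option Reg → Type
  | none => Bool
  | some _ => Cell

/-- The stacks of a machine with the given working stacks and an empty output stack. -/
def Store.stackMap (s : Store) : ∀ k, List (StackAlphabet k)
  | none => []
  | some r => s.get r

theorem Store.update_stackMap (s : Store) (r : Reg) (y : List Cell) :
    Function.update s.stackMap (some r) y = (s.set r y).stackMap := by
  funext k
  rcases k with _ | r'
  · simp [stackMap]
  · by_cases h : r' = r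
    · subst h
      simp [stackMap]
    · have : some r' ≠ some r := fun hc => h (Option.some.inj hc)
      rw [Function.update_of_ne this]
      simp [stackMap, get_set_of_ne s h]

/-- Statements of the machines built here; the internal state holds the last popped symbol. -/
abbrev StackStmt (Λ : Type) := Turing.TM2.Stmt StackAlphabet Λ (Option Cell)

/-- A program fragment: labels with their statements, which may jump to a further exit label and
can be embedded into the label set of any machine. -/
structure Prog where
  Label : Type
  fintypeLabel : Fintype Label
  entry : Label
  code : {Λ : Type} → (Label → Λ) → Λ → Label → StackStmt Λ

attribute [instance] Prog.fintypeLabel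

/-- The iterated step function of a machine. -/
def iterStep {Λ : Type} (M : Λ → StackStmt Λ) (n : ℕ)
    (c : Turing.TM2.Cfg StackAlphabet Λ (Option Cell)) :
    Option (Turing.TM2.Cfg StackAlphabet Λ (Option Cell)) :=
  (flip bind (Turing.TM2.step M))^[n] (some c)

theorem iterStep_one {Λ : Type} {M : Λ → StackStmt Λ} {l : Λ} {q : StackStmt Λ} (h : M l = q)
    (v : Option Cell) (S : ∀ k, List (StackAlphabet k)) :
    iterStep M 1 ⟨some l, v, S⟩ = some (Turing.TM2.stepAux q v S) := by
  subst h
  rfl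

theorem iterStep_add {Λ : Type} {M : Λ → StackStmt Λ} {n n' : ℕ}
    {c c' : Turing.TM2.Cfg StackAlphabet Λ (Option Cell)} (h : iterStep M n c = some c') :
    iterStep M (n' + n) c = iterStep M n' c' := by
  rw [iterStep, Function.iterate_add_apply]
  exact congrArg _ h

/-- From the stacks `s`, the fragment `P` reaches its exit with the stacks `s'` after at most `t`
steps, in whatever machine it is embedded. -/
def Runs (P : Prog) (s s' : Store) (t : ℕ) : Prop :=
  ∀ (Λ : Type) (M : Λ → StackStmt Λ) (emb : P.Label → Λ) (exit : Λ),
    (∀ l, M (emb l) = P.code emb exit l) → ∀ v, ∃ v' n, n ≤ t ∧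
      iterStep M n ⟨some (emb P.entry), v, s.stackMap⟩ = some ⟨some exit, v', s'.stackMap⟩

theorem Runs.cast {P : Prog} {s s₁ s₂ : Store} {t₁ t₂ : ℕ} (h : Runs P s s₁ t₁) (hs : s₁ = s₂)
    (ht : t₁ ≤ t₂) : Runs P s s₂ t₂ := by
  subst hs
  intro Λ M emb exit hM v
  obtain ⟨v', n, hn, h'⟩ := h Λ M emb exit hM v
  exact ⟨v', n, hn.trans ht, h'⟩

namespace Prog

/-- Do nothing. -/
def skip : Prog where
  Label := Unit
  fintypeLabel := inferInstance
  entry := ()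
  code := fun _ exit _ => .goto fun _ => exit

/-- Push a symbol. -/
def push (r : Reg) (a : Cell) : Prog where
  Label := Unit
  fintypeLabel := inferInstance
  entry := ()
  code := fun _ exit _ => .push (some r) (fun _ => a) (.goto fun _ => exit)

/-- Run two programs in turn. -/
def seq (P Q : Prog) : Prog where
  Label := P.Label ⊕ Q.Label
  fintypeLabel := inferInstance
  entry := .inl P.entry
  code := fun emb exit l => match l with
    | .inl l => P.code (fun l => emb (.inl l)) (emb (.inr Q.entry)) l
    | .inr l => Q.code (fun l => emb (.inr l)) exit l

infixr:60 " ;; " => Prog.seq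

/-- Pop a symbol and go on depending on it. -/
def pop (r : Reg) (Q : Option Cell → Prog) : Prog where
  Label := Unit ⊕ Σ o, (Q o).Label
  fintypeLabel := inferInstance
  entry := .inl ()
  code := fun emb exit l => match l with
    | .inl _ => .pop (some r) (fun _ o => o) (.goto fun o => emb (.inr ⟨o, (Q o).entry⟩))
    | .inr ⟨o, l⟩ => (Q o).code (fun l => emb (.inr ⟨o, l⟩)) exit l

/-- Pop symbols from a stack and run the given program on each, until a symbol on which `exitOn`
holds (or the empty stack, if `exitOn none`) is popped. -/
def loop (r : Reg) (exitOn : Option Cell → Bool) (Q : Option Cell → Prog) : Prog where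
  Label := Unit ⊕ Σ o, (Q o).Label
  fintypeLabel := inferInstance
  entry := .inl ()
  code := fun emb exit l => match l with
    | .inl _ => .pop (some r) (fun _ o => o)
        (.goto fun o => if exitOn o then exit else emb (.inr ⟨o, (Q o).entry⟩))
    | .inr ⟨o, l⟩ => (Q o).code (fun l => emb (.inr ⟨o, l⟩)) (emb (.inl ())) l

end Prog

open Prog

theorem runs_skip (s : Store) : Runs skip s s 1 := by
  intro Λ M emb exit hM v
  refine ⟨v, 1, le_rfl, ?_⟩
  refine (iterStep_one (hM _) v _).trans ?_
  rfl

theorem runs_push (r : Reg) (a : Cell) (s : Store) :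
    Runs (push r a) s (s.set r (a :: s.get r)) 1 := by
  intro Λ M emb exit hM v
  refine ⟨v, 1, le_rfl, ?_⟩
  refine (iterStep_one (hM _) v _).trans ?_
  rw [← Store.update_stackMap]
  rfl

/-- The exit of `P` is instantiated with the entry of `Q`; this is why `Runs` quantifies over all
machines, embeddings and exits. -/
theorem Runs.seq {P Q : Prog} {s s₁ s₂ : Store} {t₁ t₂ : ℕ} (hP : Runs P s s₁ t₁)
    (hQ : Runs Q s₁ s₂ t₂) : Runs (P ;; Q) s s₂ (t₁ + t₂) := by
  intro Λ M emb exit hM v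
  obtain ⟨v₁, n₁, h₁, e₁⟩ := hP Λ M (fun l => emb (.inl l)) (emb (.inr Q.entry))
    (fun l => hM (.inl l)) v
  obtain ⟨v₂, n₂, h₂, e₂⟩ := hQ Λ M (fun l => emb (.inr l)) exit (fun l => hM (.inr l)) v₁
  exact ⟨v₂, n₂ + n₁, by omega, (iterStep_add e₁).trans e₂⟩

theorem runs_pop {r : Reg} {Q : Option Cell → Prog} {s s' : Store} {t : ℕ}
    (h : Runs (Q (s.get r).head?) (s.set r (s.get r).tail) s' t) :
    Runs (pop r Q) s s' (t + 1) := by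
  intro Λ M emb exit hM v
  obtain ⟨v₂, n₂, h₂, e₂⟩ := h Λ M (fun l => emb (.inr ⟨_, l⟩)) exit (fun l => hM (.inr ⟨_, l⟩))
    (s.get r).head?
  refine ⟨v₂, n₂ + 1, by omega, Eq.trans (iterStep_add ?_) e₂⟩
  refine (iterStep_one (hM _) v _).trans ?_
  rw [← Store.update_stackMap]
  rfl

theorem runs_loop_exit {r : Reg} {exitOn : Option Cell → Bool} {Q : Option Cell → Prog} {s : Store}
    (h : exitOn (s.get r).head? = true) : Runs (loop r exitOn Q) s (s.set r (s.get r).tail) 1 := by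
  intro Λ M emb exit hM v
  refine ⟨(s.get r).head?, 1, le_rfl, ?_⟩
  refine (iterStep_one (hM _) v _).trans ?_
  rw [← Store.update_stackMap]
  change some (Turing.TM2.Cfg.mk (some (if exitOn (s.get r).head? = true then exit else _)) _ _) = _
  rw [if_pos h]
  rfl

/-- One unrolling: the body exits to the entry of the loop. Loops are then handled by induction on
the data, with the remaining run as a hypothesis. -/
theorem runs_loop_step {r : Reg} {exitOn : Option Cell → Bool} {Q : Option Cell → Prog}
    {s s₁ s₂ : Store} {t₁ t₂ : ℕ} (h : exitOn (s.get r).head? = false)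
    (h₁ : Runs (Q (s.get r).head?) (s.set r (s.get r).tail) s₁ t₁)
    (h₂ : Runs (loop r exitOn Q) s₁ s₂ t₂) : Runs (loop r exitOn Q) s s₂ (t₁ + t₂ + 1) := by
  intro Λ M emb exit hM v
  obtain ⟨v₁, n₁, h₁, e₁⟩ := h₁ Λ M (fun l => emb (.inr ⟨_, l⟩)) (emb (.inl ()))
    (fun l => hM (.inr ⟨_, l⟩)) (s.get r).head?
  obtain ⟨v₂, n₂, h₂, e₂⟩ := h₂ Λ M emb exit hM v₁
  refine ⟨v₂, n₂ + n₁ + 1, by omega, Eq.trans (iterStep_add ?_) ((iterStep_add e₁).trans e₂)⟩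
  refine (iterStep_one (hM _) v _).trans ?_
  rw [← Store.update_stackMap]
  change some (Turing.TM2.Cfg.mk (some (if exitOn (s.get r).head? = true then exit else _)) _ _) = _
  rw [if_neg (by simp [h])]
  rfl

namespace Prog

/-- Pop all symbols from a stack and run the given program on each. -/
def forEach (r : Reg) (Q : Cell → Prog) : Prog :=
  loop r Option.isNone fun o => o.elim skip Q

/-- Pop the bits of a word up to its end marker, and run the given program on each. -/
def forWord (r : Reg) (Q : Bool → Prog) : Prog :=
  loop r (fun o => o.all Option.isNone) fun o => (o.bind id).elim skip Q

/-- Run `P` if a stack is empty, and otherwise pop a symbol `a` from it and run `Q a`. -/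
def popElim (r : Reg) (P : Prog) (Q : Cell → Prog) : Prog := pop r fun o => o.elim P Q

/-- Empty a stack. -/
def clear (r : Reg) : Prog := forEach r fun _ => skip

/-- Move the symbols of one stack to another, which reverses them. -/
def move (r r' : Reg) : Prog := forEach r fun a => push r' a

/-- Pop a symbol, if there is one, and forget it. -/
def drop (r : Reg) : Prog := pop r fun _ => skip

end Prog

theorem runs_forEach_nil {r : Reg} {Q : Cell → Prog} {s : Store} (h : s.get r = []) :
    Runs (forEach r Q) s s 1 := by
  refine (runs_loop_exit (by simp [h])).cast ?_ le_rfl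
  rw [h, List.tail_nil, ← h, Store.set_get]

theorem runs_forEach_cons {r : Reg} {Q : Cell → Prog} {s s₁ s₂ : Store} {a : Cell} {y : List Cell}
    {t₁ t₂ : ℕ} (h : s.get r = a :: y) (h₁ : Runs (Q a) (s.set r y) s₁ t₁)
    (h₂ : Runs (forEach r Q) s₁ s₂ t₂) : Runs (forEach r Q) s s₂ (t₁ + t₂ + 1) :=
  runs_loop_step (by simp [h]) (by simpa [h] using h₁) h₂

theorem runs_forWord_nil {r : Reg} {Q : Bool → Prog} {s : Store} {y : List Cell}
    (h : s.get r = none :: y) : Runs (forWord r Q) s (s.set r y) 1 := by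
  refine (runs_loop_exit (by simp [h])).cast ?_ le_rfl
  rw [h, List.tail_cons]

theorem runs_forWord_cons {r : Reg} {Q : Bool → Prog} {s s₁ s₂ : Store} {a : Bool}
    {y : List Cell} {t₁ t₂ : ℕ} (h : s.get r = some a :: y) (h₁ : Runs (Q a) (s.set r y) s₁ t₁)
    (h₂ : Runs (forWord r Q) s₁ s₂ t₂) : Runs (forWord r Q) s s₂ (t₁ + t₂ + 1) :=
  runs_loop_step (by simp [h]) (by simpa [h] using h₁) h₂

theorem runs_popElim_nil {r : Reg} {P : Prog} {Q : Cell → Prog} {s s' : Store} {t : ℕ}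
    (h : s.get r = []) (h₁ : Runs P s s' t) : Runs (popElim r P Q) s s' (t + 1) := by
  refine runs_pop ?_
  rwa [h, List.tail_nil, ← h, Store.set_get, h, List.head?_nil]

theorem runs_popElim_cons {r : Reg} {P : Prog} {Q : Cell → Prog} {s s' : Store} {a : Cell}
    {y : List Cell} {t : ℕ} (h : s.get r = a :: y) (h₁ : Runs (Q a) (s.set r y) s' t) :
    Runs (popElim r P Q) s s' (t + 1) :=
  runs_pop (by simpa [h] using h₁)

theorem runs_drop (r : Reg) (s : Store) : Runs (drop r) s (s.set r (s.get r).tail) 2 :=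
  runs_pop (runs_skip _)

theorem runs_clear (r : Reg) (s : Store) :
    Runs (clear r) s (s.set r []) (2 * (s.get r).length + 1) := by
  generalize hy : s.get r = y
  induction y generalizing s with
  | nil => exact (runs_forEach_nil hy).cast (by rw [← hy, Store.set_get]) (by omega)
  | cons a y ih =>
    exact (runs_forEach_cons hy (runs_skip _) (ih (s.set r y) (by simp))).cast (by simp)
      (by simp; omega)

theorem runs_move {r r' : Reg} (hr : r' ≠ r) (s : Store) :
    Runs (move r r') s ((s.set r' ((s.get r).reverse ++ s.get r')).set r [])
      (2 * (s.get r).length + 1) := by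
  generalize hy : s.get r = y
  induction y generalizing s with
  | nil =>
    refine (runs_forEach_nil hy).cast ?_ (by omega)
    rw [Store.set_comm _ hr.symm, ← hy]
    have : s.set r (s.get r) = s := s.set_get r
    rw [hy] at this ⊢
    simp [this]
  | cons a y ih =>
    refine (runs_forEach_cons hy (runs_push r' a _) (ih _ ?_)).cast ?_ (by simp; omega)
    · rw [Store.get_set_of_ne _ hr.symm, Store.get_set_self]
    · simp only [Store.get_set_self, Store.set_set, Store.get_set_of_ne _ hr,
        List.reverse_cons, List.append_assoc, List.singleton_append]
      rw [Store.set_comm _ hr, Store.set_set]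

/-! ### Unary numbers and truncated conversion from binary. -/

/-- The symbol of unary numbers. -/
def tick : Cell := some true

/-- A stack that holds the number `n` in unary. -/
def ticks (n : ℕ) : List Cell := List.replicate n tick

@[simp] theorem ticks_zero : ticks 0 = [] := rfl

theorem ticks_succ (n : ℕ) : ticks (n + 1) = tick :: ticks n := rfl

@[simp] theorem length_ticks (n : ℕ) : (ticks n).length = n := List.length_replicate

@[simp] theorem tail_ticks (n : ℕ) : (ticks n).tail = ticks (n - 1) := List.tail_replicate

@[simp] theorem reverse_ticks (n : ℕ) : (ticks n).reverse = ticks n := List.reverse_replicate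

theorem ticks_append (m n : ℕ) : ticks m ++ ticks n = ticks (m + n) := List.replicate_append_replicate

theorem tick_cons_ticks (n : ℕ) : tick :: ticks n = ticks (n + 1) := rfl

namespace Prog

/-- Move a tick from the token stack to the stack `tmp`, if there is one. -/
def payTick : Prog := popElim .tok skip fun _ => push .tmp tick

/-- Double a unary number, as far as there are tokens for it. -/
def double : Prog := forEach .una fun _ => push .tmp tick ;; payTick

/-- Append a binary digit to a unary number, as far as there are tokens for it. -/
def appendDigit (a : Cell) : Prog :=
  double ;; (if a = tick then payTick else skip) ;; move .tmp .una

/-- Convert a binary number to unary. -/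
def toUnary : Prog := forEach .bits appendDigit

end Prog

theorem runs_payTick {s : Store} {c d : ℕ} (hc : s.tok = ticks c) (hd : s.tmp = ticks d) :
    Runs payTick s { s with tok := ticks (c - 1), tmp := ticks (d + min c 1) } 2 := by
  cases c with
  | zero =>
    refine Runs.cast (runs_popElim_nil hc (runs_skip s)) ?_ le_rfl
    cases s
    simp_all
  | succ c =>
    refine Runs.cast (runs_popElim_cons hc (runs_push .tmp tick _)) ?_ le_rfl
    simp only [Store.set, Store.get, hd, tick_cons_ticks]
    simp
    rfl

theorem runs_double (v : ℕ) : ∀ {s : Store} {c d : ℕ}, s.una = ticks v → s.tok = ticks c →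
    s.tmp = ticks d →
    Runs double s { s with una := [], tok := ticks (c - v), tmp := ticks (d + v + min v c) }
      (4 * v + 1) := by
  induction v with
  | zero =>
    intro s c d hv hc hd
    refine Runs.cast (runs_forEach_nil hv) ?_ (by omega)
    cases s
    simp_all
  | succ v ih =>
    intro s c d hv hc hd
    refine Runs.cast (runs_forEach_cons hv (Runs.seq (runs_push .tmp tick _)
      (runs_payTick (c := c) (d := d + 1) hc (congrArg _ hd))) (ih rfl rfl rfl)) ?_ (by omega)
    simp only [Store.set, Store.get, Store.mk.injEq, true_and, and_true]
    exact ⟨congrArg ticks (by omega), congrArg ticks (by omega)⟩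

/-- A binary number can be exponential in the input length, so it is computed only up to `C`. The
invariant is that `una` and `tok` together hold `C` ticks: old ticks are already paid for, every new
one costs a token, and running out of tokens is the truncation. -/
theorem runs_appendDigit {C v : ℕ} (hvC : v ≤ C) (b : Bool) {s : Store} (hv : s.una = ticks v)
    (hc : s.tok = ticks (C - v)) (hd : s.tmp = []) :
    Runs (appendDigit (some b)) s { s with
        una := ticks (min (2 * v + b.toNat) C)
        tok := ticks (C - min (2 * v + b.toNat) C) } (6 * C + 4) := by
  have h₁ := runs_double v hv hc (d := 0) hd
  have h₂ : Runs (if some b = tick then payTick else skip)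
      { s with una := [], tok := ticks (C - v - v), tmp := ticks (0 + v + min v (C - v)) }
      { s with
        una := []
        tok := ticks (C - min (2 * v + b.toNat) C)
        tmp := ticks (min (2 * v + b.toNat) C) } 2 := by
    cases b
    · refine Runs.cast (runs_skip _) ?_ (by omega)
      simp only [Store.mk.injEq, true_and, and_true, Bool.toNat_false]
      exact ⟨congrArg ticks (by omega), congrArg ticks (by omega)⟩
    · refine Runs.cast (runs_payTick rfl rfl) ?_ (by omega)
      simp only [Store.mk.injEq, true_and, and_true, Bool.toNat_true]
      exact ⟨congrArg ticks (by omega), congrArg ticks (by omega)⟩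
  refine Runs.cast (Runs.seq h₁ (Runs.seq h₂ (runs_move (by decide) _))) ?_ ?_
  · simp [Store.set, Store.get, hd]
  · simp only [Store.get, length_ticks]
    omega

/-- The number with the given binary digits, most significant first, after the digits of `v`. -/
def appendDigits (v : ℕ) (bs : List Bool) : ℕ := bs.foldl (fun v b => 2 * v + b.toNat) v

theorem appendDigits_reverse_bits (n : ℕ) : appendDigits 0 n.bits.reverse = n := by
  induction n using Nat.binaryRec' with
  | zero => simp [appendDigits]
  | bit b n h ih =>
    rw [Nat.bits_append_bit n b h]
    simp only [appendDigits, List.reverse_cons, List.foldl_append, List.foldl_cons,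
      List.foldl_nil] at ih ⊢
    rw [ih, Nat.bit_val]

theorem le_appendDigits (v : ℕ) (bs : List Bool) : v ≤ appendDigits v bs := by
  induction bs generalizing v with
  | nil => exact le_rfl
  | cons b bs ih => exact le_trans (by omega) (ih (2 * v + b.toNat))

/-- Truncating after every digit agrees with truncating at the end, because further digits never
decrease a value that has reached `C`. -/
theorem min_appendDigits_min (v C : ℕ) (bs : List Bool) :
    min (appendDigits (min v C) bs) C = min (appendDigits v bs) C := by
  rcases le_total v C with h | h
  · rw [min_eq_left h]
  · have h1 := le_appendDigits C bs
    have h2 := le_appendDigits v bs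
    rw [min_eq_right h]
    omega

theorem runs_toUnary (C : ℕ) (bs : List Bool) : ∀ {s : Store} {v : ℕ}, v ≤ C →
    s.bits = bs.map some → s.una = ticks v → s.tok = ticks (C - v) → s.tmp = [] →
    Runs toUnary s { s with
        bits := []
        una := ticks (min (appendDigits v bs) C)
        tok := ticks (C - min (appendDigits v bs) C) } (bs.length * (6 * C + 5) + 1) := by
  induction bs with
  | nil =>
    intro s v hvC hb hv hc hd
    refine Runs.cast (runs_forEach_nil hb) ?_ (by omega)
    have : min (appendDigits v []) C = v := min_eq_left hvC
    cases s
    simp_all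
  | cons b bs ih =>
    intro s v hvC hb hv hc hd
    refine Runs.cast (runs_forEach_cons hb (runs_appendDigit hvC b hv hc hd)
      (ih (v := min (2 * v + b.toNat) C) (by omega) rfl rfl rfl hd)) ?_ ?_
    · simp only [Store.set, min_appendDigits_min]
      rfl
    · simp only [List.length_cons]
      ring_nf
      omega

/-! ### Counting the classes of rows under a mask. -/

theorem encodeWords_cons (w : List Bool) (ws : List (List Bool)) :
    encodeWords (w :: ws) = w.map some ++ none :: encodeWords ws := by
  simp [encodeWords]

theorem length_encodeWords {n : ℕ} {ws : List (List Bool)} (h : ∀ w ∈ ws, w.length = n) :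
    (encodeWords ws).length = ws.length * (n + 1) := by
  induction ws with
  | nil => simp [encodeWords]
  | cons w ws ih =>
    rw [encodeWords_cons, List.length_append, List.length_cons, List.length_map,
      ih fun v hv => h v (List.mem_cons_of_mem w hv), h w List.mem_cons_self, List.length_cons]
    ring

/-- The position of a pattern for a row: `none`, which matches every bit, outside the mask. -/
def patternCell (m b : Bool) : Cell := if m then some b else none

/-- A position of a pattern does not match a bit. -/
def mismatch (x : Cell) (b : Bool) : Bool := x.any (· != b)

/-- The number of positions where a row does not match a pattern. -/
def mismatches (p : List Cell) (d : List Bool) : ℕ := (List.zipWith mismatch p d).count true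

theorem mismatches_cons (x : Cell) (p : List Cell) (b : Bool) (d : List Bool) :
    mismatches (x :: p) (b :: d) = mismatches p d + if mismatch x b then 1 else 0 := by
  simp [mismatches, List.count_cons]

theorem mismatches_le (p : List Cell) (d : List Bool) : mismatches p d ≤ d.length := by
  refine List.count_le_length.trans ?_
  simp

namespace Prog

/-- Pop a row from `mat` and put it as a pattern on `pat`. -/
def readPattern : Prog :=
  forWord .mat (fun b => popElim .mask skip fun m =>
    push .tmp m ;; push .pat2 (if m = tick then some b else none)) ;;
  move .tmp .mask ;; move .pat2 .pat

/-- Compare the next symbol of a row with the pattern, and copy it to `mat2`; at the end of the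
row, remove the copy if it has matched the pattern. -/
def scanCell : Cell → Prog
  | some b => popElim .pat skip fun x => push .pat2 x ;; push .mat2 (some b) ;;
      if mismatch x b then push .flag tick else skip
  | none => popElim .flag (forEach .pat2 fun x => push .pat x ;; drop .mat2)
      fun _ => clear .flag ;; move .pat2 .pat ;; push .mat2 none

/-- Move the rows that do not match the pattern from `mat` to `mat2`. -/
def scan : Prog := forEach .mat scanCell

/-- Remove all rows of the class of the first row. -/
def removeClass : Prog :=
  readPattern ;; scan ;; clear .pat ;; move .mat2 .mat ;; drop .goal2

/-- Remove the rows class by class, with a tick of `goal2` for each class. -/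
def removeClasses : Prog := forEach .mat fun a => push .mat a ;; removeClass

end Prog

theorem runs_readPattern {n : ℕ} {m d : List Bool} {s : Store} {y : List Cell}
    (hm : m.length = n) (hd : d.length = n) (h₁ : s.mat = d.map some ++ none :: y)
    (h₂ : s.mask = m.map some) (h₃ : s.tmp = []) (h₄ : s.pat2 = []) (h₅ : s.pat = []) :
    Runs readPattern s { s with mat := y, pat := List.zipWith patternCell m d } (8 * n + 3) := by
  have key : ∀ (m d : List Bool) (s : Store), m.length = d.length →
      s.mat = d.map some ++ none :: y → s.mask = m.map some →
      Runs (forWord .mat fun b => popElim .mask skip fun m =>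
        push .tmp m ;; push .pat2 (if m = tick then some b else none)) s
        { s with
          mat := y
          mask := []
          tmp := (m.map some).reverse ++ s.tmp
          pat2 := (List.zipWith patternCell m d).reverse ++ s.pat2 } (4 * d.length + 1) := by
    intro m d
    induction d generalizing m with
    | nil =>
      intro s hl h₁ h₂
      obtain rfl : m = [] := by simpa using hl
      refine Runs.cast (runs_forWord_nil h₁) ?_ (by omega)
      cases s
      simp_all [Store.set]
    | cons b d ih =>
      intro s hl h₁ h₂
      cases m with
      | nil => simp at hl
      | cons x m =>
        refine Runs.cast (runs_forWord_cons h₁ (runs_popElim_cons h₂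
          (Runs.seq (runs_push .tmp _ _) (runs_push .pat2 _ _)))
          (ih m _ (by simpa using hl) rfl rfl)) ?_ ?_
        · cases x <;> simp [Store.set, Store.get, tick, patternCell]
        · simp only [List.length_cons]
          omega
  refine Runs.cast (Runs.seq (key m d s (hm.trans hd.symm) h₁ h₂)
    (Runs.seq (runs_move (by decide) _) (runs_move (by decide) _))) ?_ ?_
  · cases s
    simp_all [Store.set, Store.get]
  · simp [Store.set, Store.get, h₃, h₄, hm, hd]
    omega

/-- `scan` is a single loop over the symbols of all rows, so a row is not a subprogram. Hence the
run from the end marker onwards is assumed and the row is prepended to it. -/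
theorem runs_scan_word {y : List Cell} {s' : Store} {t : ℕ} (d : List Bool) :
    ∀ (p : List Cell) (s : Store), p.length = d.length → s.mat = d.map some ++ none :: y →
      s.pat = p →
      Runs scan { s with
          mat := none :: y
          pat := []
          pat2 := p.reverse ++ s.pat2
          mat2 := (d.map some).reverse ++ s.mat2
          flag := ticks (mismatches p d) ++ s.flag } s' t →
      Runs scan s s' (5 * d.length + t) := by
  induction d with
  | nil =>
    intro p s hl h₁ h₂ h
    obtain rfl : p = [] := by simpa using hl
    have : s = { s with
        mat := none :: y
        pat := []
        pat2 := [].reverse ++ s.pat2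
        mat2 := ([].map some).reverse ++ s.mat2
        flag := ticks (mismatches [] []) ++ s.flag } := by
      cases s
      simp_all [mismatches]
    rw [this]
    exact Runs.cast h rfl (by omega)
  | cons b d ih =>
    intro p s hl h₁ h₂ h
    cases p with
    | nil => simp at hl
    | cons x p =>
      have hflag : Runs (if mismatch x b then push .flag tick else skip)
          { s with
            mat := d.map some ++ none :: y
            pat := p
            pat2 := x :: s.pat2
            mat2 := some b :: s.mat2 }
          { s with
            mat := d.map some ++ none :: y
            pat := p
            pat2 := x :: s.pat2
            mat2 := some b :: s.mat2
            flag := ticks (if mismatch x b then 1 else 0) ++ s.flag } 1 := by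
        cases mismatch x b
        · exact Runs.cast (runs_skip _) (by simp) le_rfl
        · exact Runs.cast (runs_push _ _ _) (by simp [Store.set, Store.get, ticks]) le_rfl
      refine Runs.cast (runs_forEach_cons h₁ (runs_popElim_cons h₂
        (Runs.seq (runs_push .pat2 _ _) (Runs.seq (runs_push .mat2 _ _) hflag)))
        (ih p _ (by simpa using hl) rfl rfl ?_)) rfl ?_
      · convert h using 1
        simp [mismatches_cons, ← ticks_append]
      · simp only [List.length_cons]
        omega

/-- This undoes the copy of a matching row: row and pattern have equal length, so one symbol of
`mat2` goes for each pattern symbol put back. -/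
theorem runs_restore (p : List Cell) : ∀ {s : Store}, s.pat2 = p →
    Runs (forEach .pat2 fun x => push .pat x ;; drop .mat2) s
      { s with pat2 := [], pat := p.reverse ++ s.pat, mat2 := s.mat2.drop p.length }
      (4 * p.length + 1) := by
  induction p with
  | nil =>
    intro s h
    refine Runs.cast (runs_forEach_nil h) ?_ (by simp)
    cases s
    simp_all
  | cons x p ih =>
    intro s h
    refine Runs.cast (runs_forEach_cons h (Runs.seq (runs_push .pat x _) (runs_drop .mat2 _))
      (ih rfl)) ?_ ?_
    · simp [Store.set, Store.get]
    · simp only [List.length_cons]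
      omega

theorem runs_scan {n : ℕ} {p : List Cell} (hp : p.length = n) (ds : List (List Bool)) :
    ∀ {s : Store}, (∀ d ∈ ds, d.length = n) → s.mat = encodeWords ds → s.pat = p →
      s.pat2 = [] → s.flag = [] →
      Runs scan s { s with
          mat := []
          mat2 := (encodeWords (ds.filter fun d => mismatches p d ≠ 0)).reverse ++ s.mat2 }
        (ds.length * (9 * n + 7) + 1) := by
  induction ds with
  | nil =>
    intro s _ h₁ h₂ h₃ h₄
    refine Runs.cast (runs_forEach_nil h₁) ?_ (by simp)
    cases s
    simp_all [encodeWords]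
  | cons d ds ih =>
    intro s hlen h₁ h₂ h₃ h₄
    have hd := hlen d List.mem_cons_self
    have hle := mismatches_le p d
    rw [encodeWords_cons] at h₁
    by_cases hm : mismatches p d = 0
    · have hfilter : (d :: ds).filter (fun d => mismatches p d ≠ 0) =
          ds.filter fun d => mismatches p d ≠ 0 := by
        simp [hm]
      refine Runs.cast (runs_scan_word d p s (hp.trans hd.symm) h₁ h₂ (runs_forEach_cons rfl
        (runs_popElim_nil (by simp [Store.get, Store.set, hm, h₄]) (runs_restore p.reverse
          (by simp [Store.set, h₃])))
        (ih (fun v hv => hlen v (List.mem_cons_of_mem d hv)) rfl (by simp [Store.set]) rfl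
          (by simp [Store.set, hm, h₄])))) ?_ ?_
      · rw [hfilter]
        have hdrop : List.drop p.length ((d.map some).reverse ++ s.mat2) = s.mat2 :=
          List.drop_left' (by simp [hp, hd])
        cases s
        simp_all [Store.set]
      · simp only [List.length_cons, List.length_reverse, hp, hd]
        ring_nf
        omega
    · have hfilter : (d :: ds).filter (fun d => mismatches p d ≠ 0) =
          d :: ds.filter fun d => mismatches p d ≠ 0 := by
        simp [hm]
      obtain ⟨c, hc⟩ := Nat.exists_eq_succ_of_ne_zero hm
      refine Runs.cast (runs_scan_word d p s (hp.trans hd.symm) h₁ h₂ (runs_forEach_cons rfl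
        (runs_popElim_cons (a := tick) (y := ticks c)
          (by simp [Store.get, Store.set, hc, h₄, ticks_succ])
          (Runs.seq (runs_clear .flag _) (Runs.seq (runs_move (by decide) _)
            (runs_push .mat2 none _))))
        (ih (fun v hv => hlen v (List.mem_cons_of_mem d hv)) rfl
          (by simp [Store.set, Store.get, h₃]) rfl rfl))) ?_ ?_
      · rw [hfilter, encodeWords_cons]
        cases s
        simp_all [Store.set, Store.get]
      · simp only [Store.get, Store.set, List.length_cons, List.length_reverse,
          List.length_append, length_ticks, hp, hd, h₃, List.length_nil]
        ring_nf
        omega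

/-- The pattern prescribes bits only inside the mask, so matching it means lying in the class of
`c`. -/
theorem mismatches_pattern_eq_zero_iff (m c d : List Bool) (hc : c.length = m.length)
    (hd : d.length = m.length) :
    mismatches (List.zipWith patternCell m c) d = 0 ↔
      List.zipWith and m d = List.zipWith and m c := by
  induction m generalizing c d with
  | nil => simp [mismatches]
  | cons x m ih =>
    cases c with
    | nil => simp at hc
    | cons y c =>
      cases d with
      | nil => simp at hd
      | cons z d =>
        have := ih c d (by simpa using hc) (by simpa using hd)
        simp only [List.zipWith_cons_cons, mismatches_cons, List.cons.injEq, ← this,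
          Nat.add_eq_zero_iff]
        cases x <;> cases y <;> cases z <;> simp [mismatch, patternCell]

/-- The number of classes of the rows `ds` under the mask `m`. -/
def classCount (m : List Bool) (ds : List (List Bool)) : ℕ :=
  ((ds.map (List.zipWith and m)).toFinset).card

/-- The recursion that `removeClasses` follows: deleting the class of the first row loses exactly
one class. -/
theorem classCount_cons (m c : List Bool) (ds : List (List Bool)) :
    classCount m (c :: ds) = classCount m
      (ds.filter fun d => List.zipWith and m d ≠ List.zipWith and m c) + 1 := by
  have : ((c :: ds).map (List.zipWith and m)).toFinset =
      insert (List.zipWith and m c)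
        ((ds.filter fun d => List.zipWith and m d ≠ List.zipWith and m c).map
          (List.zipWith and m)).toFinset := by
    ext a
    simp only [List.map_cons, List.toFinset_cons, Finset.mem_insert, List.mem_toFinset,
      List.mem_map, List.mem_filter, decide_eq_true_eq]
    constructor
    · rintro (rfl | ⟨d, hd, rfl⟩)
      · exact Or.inl rfl
      · by_cases h : List.zipWith and m d = List.zipWith and m c
        · exact Or.inl h
        · exact Or.inr ⟨d, ⟨hd, h⟩, rfl⟩
    · rintro (rfl | ⟨d, ⟨hd, -⟩, rfl⟩)
      · exact Or.inl rfl
      · exact Or.inr ⟨d, hd, rfl⟩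
  rw [classCount, this, Finset.card_insert_of_notMem, classCount]
  simp

theorem runs_removeClass {n : ℕ} {m c : List Bool} {ds : List (List Bool)} {s : Store}
    (hm : m.length = n) (hlen : ∀ d ∈ c :: ds, d.length = n) (h₁ : s.mat = encodeWords (c :: ds))
    (h₂ : s.mask = m.map some) (h₃ : s.tmp = []) (h₄ : s.pat2 = []) (h₅ : s.pat = [])
    (h₆ : s.flag = []) (h₇ : s.mat2 = []) :
    Runs removeClass s { s with
        mat := encodeWords
          (ds.filter fun d => List.zipWith and m d ≠ List.zipWith and m c)
        goal2 := s.goal2.tail } ((c :: ds).length * (11 * n + 10)) := by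
  have hc := hlen c List.mem_cons_self
  have hds : ∀ d ∈ ds, d.length = n := fun d hd => hlen d (List.mem_cons_of_mem c hd)
  have hf : (ds.filter fun d => mismatches (List.zipWith patternCell m c) d ≠ 0) =
      ds.filter fun d => List.zipWith and m d ≠ List.zipWith and m c :=
    List.filter_congr fun d hd => by
      simp only [ne_eq, mismatches_pattern_eq_zero_iff m c d (hc.trans hm.symm)
        ((hds d hd).trans hm.symm)]
  rw [encodeWords_cons] at h₁
  have hp : (List.zipWith patternCell m c).length = n := by simp [hm, hc]
  have hlen2 := length_encodeWords (n := n)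
    (ws := ds.filter fun d => List.zipWith and m d ≠ List.zipWith and m c)
    fun d hd => hds d (List.mem_of_mem_filter hd)
  have hle := Nat.mul_le_mul_right (n + 1) (List.length_filter_le
    (fun d => decide (List.zipWith and m d ≠ List.zipWith and m c)) ds)
  refine Runs.cast (Runs.seq (runs_readPattern hm hc h₁ h₂ h₃ h₄ h₅) (Runs.seq
    (runs_scan hp ds hds rfl rfl h₄ h₆) (Runs.seq (runs_clear .pat _)
    (Runs.seq (runs_move (by decide) _) (runs_drop .goal2 _))))) ?_ ?_
  · rw [hf]
    cases s
    simp_all [Store.set, Store.get]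
  · simp only [Store.get, Store.set, hf, List.length_append, List.length_reverse, hlen2, h₇,
      List.length_nil, hp, List.length_cons]
    nlinarith [hle]

theorem runs_removeClasses {n : ℕ} {m : List Bool} (hm : m.length = n) (N : ℕ) :
    ∀ {ds : List (List Bool)} {s : Store} {g : ℕ}, ds.length ≤ N → (∀ d ∈ ds, d.length = n) →
      s.mat = encodeWords ds → s.mask = m.map some → s.tmp = [] → s.pat2 = [] → s.pat = [] →
      s.flag = [] → s.mat2 = [] → s.goal2 = ticks g →
      Runs removeClasses s { s with mat := [], goal2 := ticks (g - classCount m ds) }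
        (ds.length * (N * (11 * n + 10) + 2) + 1) := by
  -- A round may remove many rows, so the induction is on a bound `e` of their number, while `N` in
  -- the time bound stays fixed.
  suffices h : ∀ (e : ℕ) {ds : List (List Bool)} {s : Store} {g : ℕ}, ds.length ≤ e → e ≤ N →
      (∀ d ∈ ds, d.length = n) →
      s.mat = encodeWords ds → s.mask = m.map some → s.tmp = [] → s.pat2 = [] → s.pat = [] →
      s.flag = [] → s.mat2 = [] → s.goal2 = ticks g →
      Runs removeClasses s { s with mat := [], goal2 := ticks (g - classCount m ds) }
        (ds.length * (N * (11 * n + 10) + 2) + 1) by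
    intro ds s g hN
    exact h N hN le_rfl
  intro e
  induction e with
  | zero =>
    intro ds s g he _ hlen h₁ h₂ h₃ h₄ h₅ h₆ h₇ h₈
    obtain rfl : ds = [] := by simpa using he
    refine Runs.cast (runs_forEach_nil h₁) ?_ (by simp)
    cases s
    simp_all [encodeWords, classCount]
  | succ e ih =>
    intro ds s g he heN hlen h₁ h₂ h₃ h₄ h₅ h₆ h₇ h₈
    cases ds with
    | nil =>
      refine Runs.cast (runs_forEach_nil h₁) ?_ (by simp)
      cases s
      simp_all [encodeWords, classCount]
    | cons c ds =>
      have hle := List.length_filter_le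
        (fun d => decide (List.zipWith and m d ≠ List.zipWith and m c)) ds
      simp only [List.length_cons] at he
      obtain ⟨a, y, hay⟩ : ∃ a y, s.mat = a :: y := by
        rw [h₁, encodeWords_cons]
        cases c <;> simp
      -- The loop pops a symbol only to see that rows are left; the body first puts it back.
      have h₁' : (s.set .mat y).set .mat (a :: (s.set .mat y).get .mat) = s := by
        cases s
        simp_all [Store.set, Store.get]
      refine Runs.cast (runs_forEach_cons hay (Runs.seq (runs_push .mat a _)
        (runs_removeClass hm hlen ?_ ?_ ?_ ?_ ?_ ?_ ?_))
        (ih (ds := ds.filter fun d => List.zipWith and m d ≠ List.zipWith and m c) (g := g - 1)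
          (by omega) (by omega)
          (fun d hd => hlen d (List.mem_cons_of_mem c (List.mem_of_mem_filter hd))) rfl
          ?_ ?_ ?_ ?_ ?_ ?_ ?_)) ?_ ?_
      all_goals try rw [h₁']
      all_goals try assumption
      · simp [h₈]
      · rw [classCount_cons]
        simp only [Store.mk.injEq, true_and, and_true]
        exact congrArg ticks (by omega)
      · have h9 := Nat.mul_le_mul_right (11 * n + 10) (show ds.length + 1 ≤ N by omega)
        have h10 := Nat.mul_le_mul_right (N * (11 * n + 10) + 2) hle
        simp only [List.length_cons]
        rw [Nat.add_one_mul ds.length (N * _ + 2)]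
        omega

namespace Prog

/-- Copy the rows from `inp` to `mat`. -/
def copyRows : Prog := move .inp .tmp ;; forEach .tmp fun a => push .inp a ;; push .mat a

/-- Copy the required number of classes. -/
def copyGoal : Prog := move .goal .tmp ;; forEach .tmp fun a => push .goal a ;; push .goal2 a

/-- Put a tick on `ans` if the vertices in the mask induce the required number of classes. -/
def test : Prog :=
  copyRows ;; copyGoal ;; removeClasses ;;
    popElim .goal2 (push .ans tick) fun _ => clear .goal2

end Prog

theorem runs_copyRows {s : Store} (h₁ : s.tmp = []) (h₂ : s.mat = []) :
    Runs copyRows s { s with mat := s.inp } (5 * s.inp.length + 2) := by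
  have key : ∀ (y : List Cell) (s : Store), s.tmp = y →
      Runs (forEach .tmp fun a => push .inp a ;; push .mat a) s
        { s with tmp := [], inp := y.reverse ++ s.inp, mat := y.reverse ++ s.mat }
        (3 * y.length + 1) := by
    intro y
    induction y with
    | nil =>
      intro s h
      refine Runs.cast (runs_forEach_nil h) ?_ (by simp)
      cases s
      simp_all
    | cons a y ih =>
      intro s h
      refine Runs.cast (runs_forEach_cons h (Runs.seq (runs_push .inp a _) (runs_push .mat a _))
        (ih _ rfl)) ?_ ?_
      · simp [Store.set, Store.get]
      · simp only [List.length_cons]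
        omega
  refine Runs.cast (Runs.seq (runs_move (by decide) _) (key _ _ rfl)) ?_ ?_
  · cases s
    simp_all [Store.set, Store.get]
  · simp [Store.set, Store.get, h₁]
    omega

theorem runs_copyGoal {s : Store} (h₁ : s.tmp = []) (h₂ : s.goal2 = []) :
    Runs copyGoal s { s with goal2 := s.goal } (5 * s.goal.length + 2) := by
  have key : ∀ (y : List Cell) (s : Store), s.tmp = y →
      Runs (forEach .tmp fun a => push .goal a ;; push .goal2 a) s
        { s with tmp := [], goal := y.reverse ++ s.goal, goal2 := y.reverse ++ s.goal2 }
        (3 * y.length + 1) := by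
    intro y
    induction y with
    | nil =>
      intro s h
      refine Runs.cast (runs_forEach_nil h) ?_ (by simp)
      cases s
      simp_all
    | cons a y ih =>
      intro s h
      refine Runs.cast (runs_forEach_cons h (Runs.seq (runs_push .goal a _)
        (runs_push .goal2 a _)) (ih _ rfl)) ?_ ?_
      · simp [Store.set, Store.get]
      · simp only [List.length_cons]
        omega
  refine Runs.cast (Runs.seq (runs_move (by decide) _) (key _ _ rfl)) ?_ ?_
  · cases s
    simp_all [Store.set, Store.get]
  · simp [Store.set, Store.get, h₁]
    omega

/-- The auxiliary stacks of `test` are empty. -/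
structure Store.Clean (s : Store) : Prop where
  tmp : s.tmp = []
  mat : s.mat = []
  mat2 : s.mat2 = []
  pat : s.pat = []
  pat2 : s.pat2 = []
  flag : s.flag = []
  goal2 : s.goal2 = []

/-- A bound on the running time of `test`. -/
def testTime (n m g : ℕ) : ℕ := 5 * (m * (n + 1)) + m * (m * (11 * n + 10) + 2) + 7 * g + 9

/-- Dropping from an empty stack has no effect, which matches truncated subtraction: `goal2` ends up
empty exactly if there are at least `g` classes. -/
theorem runs_test {n g : ℕ} {m : List Bool} {ds : List (List Bool)} {s : Store}
    (hm : m.length = n) (hlen : ∀ d ∈ ds, d.length = n) (hs : s.Clean)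
    (h₁ : s.inp = encodeWords ds) (h₂ : s.mask = m.map some) (h₃ : s.goal = ticks g) :
    Runs test s { s with ans := if g ≤ classCount m ds then tick :: s.ans else s.ans }
      (testTime n ds.length g) := by
  obtain ⟨c₁, c₂, c₃, c₄, c₅, c₆, c₇⟩ := hs
  have hl : s.inp.length = ds.length * (n + 1) := by rw [h₁, length_encodeWords hlen]
  have hg : s.goal.length = g := by rw [h₃, length_ticks]
  have hend : Runs (popElim .goal2 (push .ans tick) fun _ => clear .goal2)
      { s with goal2 := ticks (g - classCount m ds) }
      { s with ans := if g ≤ classCount m ds then tick :: s.ans else s.ans } (2 * g + 4) := by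
    split_ifs with h
    · refine Runs.cast (runs_popElim_nil (by simp [Store.get, h]) (runs_push .ans tick _)) ?_
        (by omega)
      cases s
      simp_all [Store.set, Store.get]
    · obtain ⟨e, he⟩ : ∃ e, g - classCount m ds = e + 1 := ⟨g - classCount m ds - 1, by omega⟩
      refine Runs.cast (runs_popElim_cons (by simp only [Store.get, he, ticks_succ]; rfl)
        (runs_clear .goal2 _)) ?_ ?_
      · cases s
        simp_all [Store.set]
      · simp only [Store.set, Store.get, length_ticks]
        omega
  refine Runs.cast (Runs.seq (runs_copyRows c₁ c₂) (Runs.seq (runs_copyGoal c₁ c₇)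
    (Runs.seq (runs_removeClasses (g := g) hm ds.length le_rfl hlen h₁ h₂ c₁ c₅ c₄ c₆ c₃ h₃)
      (Runs.cast (s₁ := { s with ans := if g ≤ classCount m ds then tick :: s.ans else s.ans })
        (t₁ := 2 * g + 4) ?_ rfl le_rfl)))) rfl ?_
  · convert hend using 1
    cases s
    simp_all
  · simp only [hl, hg, testTime]
    omega

/-! ### Enumeration of the candidate sets as masks. -/

/-- All words that arise from `u.reverse ++ w` by setting one bit of `w`. -/
def setBits (u : List Bool) : List Bool → List (List Bool)
  | [] => []
  | a :: w => (u.reverse ++ true :: w) :: setBits (a :: u) w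

theorem length_setBits (u w : List Bool) : (setBits u w).length = w.length := by
  induction w generalizing u with
  | nil => rfl
  | cons a w ih => simp [setBits, ih]

theorem length_of_mem_setBits {u w v : List Bool} (h : v ∈ setBits u w) :
    v.length = u.length + w.length := by
  induction w generalizing u with
  | nil => simp [setBits] at h
  | cons a w ih =>
    rcases List.mem_cons.1 h with rfl | h
    · simp
    · rw [ih h]
      simp only [List.length_cons]
      omega

theorem count_le_of_mem_setBits {u w v : List Bool} (h : v ∈ setBits u w) :
    v.count true ≤ u.count true + w.count true + 1 := by
  induction w generalizing u with
  | nil => simp [setBits] at h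
  | cons a w ih =>
    rcases List.mem_cons.1 h with rfl | h
    · simp only [List.count_append, List.count_reverse, List.count_cons, beq_self_eq_true,
        if_true]
      omega
    · refine (ih h).trans ?_
      simp only [List.count_cons]
      omega

theorem mem_setBits (u v w : List Bool) (a : Bool) :
    u.reverse ++ v ++ true :: w ∈ setBits u (v ++ a :: w) := by
  induction v generalizing u with
  | nil => simp [setBits]
  | cons b v ih =>
    refine List.mem_cons_of_mem _ ?_
    simpa using ih (b :: u)

/-- Masks of length `n` with up to `r` bits set, among them all those with exactly `r`. -/
def masks (n : ℕ) : ℕ → List (List Bool)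
  | 0 => [List.replicate n false]
  | r + 1 => (masks n r).flatMap fun w => setBits [] w.reverse

theorem length_of_mem_masks {n r : ℕ} {w : List Bool} (h : w ∈ masks n r) : w.length = n := by
  induction r generalizing w with
  | zero =>
    obtain rfl := List.mem_singleton.1 h
    simp
  | succ r ih =>
    obtain ⟨v, hv, hw⟩ := List.mem_flatMap.1 h
    rw [length_of_mem_setBits hw, List.length_reverse, ih hv, List.length_nil, zero_add]

theorem count_le_of_mem_masks {n r : ℕ} {w : List Bool} (h : w ∈ masks n r) :
    w.count true ≤ r := by
  induction r generalizing w with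
  | zero =>
    obtain rfl := List.mem_singleton.1 h
    simp [List.count_replicate]
  | succ r ih =>
    obtain ⟨v, hv, hw⟩ := List.mem_flatMap.1 h
    have h₁ := count_le_of_mem_setBits hw
    have h₂ := ih hv
    simp only [List.count_reverse, List.count_nil] at h₁
    omega

/-- Clearing one set bit gives a mask of the previous round, from which `w` arises by setting that
bit again. -/
theorem mem_masks {n r : ℕ} {w : List Bool} (hn : w.length = n) (hr : w.count true = r) :
    w ∈ masks n r := by
  induction r generalizing w with
  | zero =>
    refine List.mem_singleton.2 (List.eq_replicate_iff.2 ⟨hn, fun b hb => ?_⟩)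
    cases b
    · rfl
    · exact absurd hb (List.count_eq_zero.1 hr)
  | succ r ih =>
    obtain ⟨u, v, rfl⟩ := List.append_of_mem (List.count_pos_iff.1 (by omega : 0 < w.count true))
    refine List.mem_flatMap.2 ⟨(u ++ false :: v).reverse, ih ?_ ?_, ?_⟩
    · simp only [List.length_reverse, List.length_append, List.length_cons] at hn ⊢
      exact hn
    · simp only [List.count_reverse, List.count_append, List.count_cons] at hr ⊢
      simp at hr ⊢
      omega
    · rw [List.reverse_reverse]
      simpa using mem_setBits [] u v false

/-- Bits that are already set are "set" again, so every word has exactly `n` successors. The price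
is repetitions and masks with fewer than `r` bits, both harmless. -/
theorem length_masks (n r : ℕ) : (masks n r).length = n ^ r := by
  induction r with
  | zero => rfl
  | succ r ih =>
    rw [masks, List.length_flatMap, List.map_congr_left (g := fun _ => n), List.map_const',
      List.sum_replicate, ih, pow_succ, smul_eq_mul]
    intro w hw
    rw [length_setBits, List.length_reverse, length_of_mem_masks hw]

namespace Prog

/-- Write the current mask with its next bit set on `sets2`. -/
def emit : Prog :=
  move .pre .tmp ;; (forEach .tmp fun a => push .pre a ;; push .sets2 a) ;; push .sets2 tick ;;
  (forEach .mask fun a => push .tmp a ;; push .sets2 a) ;; move .tmp .mask ;; push .sets2 none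

/-- Write all masks that arise from the current mask by setting a bit. -/
def emitAll : Prog := (forEach .mask fun a => emit ;; push .pre a) ;; clear .pre

/-- Load every set from `sets` as a mask and run `P`. -/
def forSets (P : Prog) : Prog := forEach .sets fun a => if a.isSome then push .mask a else P

/-- Replace every set by all sets that arise by setting a bit. -/
def expand : Prog := forSets emitAll ;; move .sets2 .sets

end Prog

/-- The words pile up backwards on `sets2`; the final move in `expand` restores the reading order.
-/
theorem runs_emit {s : Store} (h : s.tmp = []) :
    Runs emit s { s with sets2 := none :: ((s.pre.reverse ++ tick :: s.mask).reverse ++ s.sets2) }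
      (5 * s.pre.length + 5 * s.mask.length + 6) := by
  have key₁ : ∀ (y : List Cell) (s : Store), s.tmp = y →
      Runs (forEach .tmp fun a => push .pre a ;; push .sets2 a) s
        { s with tmp := [], pre := y.reverse ++ s.pre, sets2 := y.reverse ++ s.sets2 }
        (3 * y.length + 1) := by
    intro y
    induction y with
    | nil =>
      intro s h
      refine Runs.cast (runs_forEach_nil h) ?_ (by simp)
      cases s
      simp_all
    | cons a y ih =>
      intro s h
      refine Runs.cast (runs_forEach_cons h (Runs.seq (runs_push .pre a _)
        (runs_push .sets2 a _)) (ih _ rfl)) ?_ ?_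
      · simp [Store.set, Store.get]
      · simp only [List.length_cons]
        omega
  have key₂ : ∀ (y : List Cell) (s : Store), s.mask = y →
      Runs (forEach .mask fun a => push .tmp a ;; push .sets2 a) s
        { s with mask := [], tmp := y.reverse ++ s.tmp, sets2 := y.reverse ++ s.sets2 }
        (3 * y.length + 1) := by
    intro y
    induction y with
    | nil =>
      intro s h
      refine Runs.cast (runs_forEach_nil h) ?_ (by simp)
      cases s
      simp_all
    | cons a y ih =>
      intro s h
      refine Runs.cast (runs_forEach_cons h (Runs.seq (runs_push .tmp a _)
        (runs_push .sets2 a _)) (ih _ rfl)) ?_ ?_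
      · simp [Store.set, Store.get]
      · simp only [List.length_cons]
        omega
  refine Runs.cast (Runs.seq (runs_move (by decide) _) (Runs.seq (key₁ _ _ rfl)
    (Runs.seq (runs_push .sets2 tick _) (Runs.seq (key₂ _ _ rfl)
    (Runs.seq (runs_move (by decide) _) (runs_push .sets2 none _)))))) ?_ ?_
  · cases s
    simp_all [Store.set, Store.get]
  · simp [Store.set, Store.get, h]
    omega

theorem runs_emitAll {n : ℕ} {w : List Bool} {s : Store} (hn : w.length = n)
    (h₁ : s.mask = w.map some) (h₂ : s.pre = []) (h₃ : s.tmp = []) :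
    Runs emitAll s { s with
        mask := []
        sets2 := (encodeWords (setBits [] w)).reverse ++ s.sets2 } (n * (5 * n + 10) + 2) := by
  have key : ∀ (w u : List Bool) (s : Store), u.length + w.length = n → s.mask = w.map some →
      s.pre = u.map some → s.tmp = [] →
      Runs (forEach .mask fun a => emit ;; push .pre a) s { s with
          mask := []
          pre := (w.map some).reverse ++ s.pre
          sets2 := (encodeWords (setBits u w)).reverse ++ s.sets2 }
        (w.length * (5 * n + 8) + 1) := by
    intro w
    induction w with
    | nil =>
      intro u s hn h₁ h₂ h₃
      refine Runs.cast (runs_forEach_nil h₁) ?_ (by simp)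
      cases s
      simp_all [encodeWords, setBits]
    | cons a w ih =>
      intro u s hn h₁ h₂ h₃
      simp only [List.length_cons] at hn
      refine Runs.cast (runs_forEach_cons h₁ (Runs.seq (runs_emit h₃)
        (runs_push .pre (some a) _)) (ih (a :: u) _ (by simp only [List.length_cons]; omega) rfl
          (by simp [Store.set, Store.get, h₂]) h₃)) ?_ ?_
      · simp [Store.set, Store.get, setBits, encodeWords_cons, h₂, tick]
      · simp only [Store.set, h₂, List.length_map, List.length_cons]
        ring_nf
        omega
  refine Runs.cast (Runs.seq (key w [] s (by simpa using hn) h₁ h₂ h₃) (runs_clear .pre _)) ?_ ?_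
  · cases s
    simp_all [Store.set]
  · simp [Store.get, h₂, hn]
    ring_nf
    omega

theorem runs_forSets_nil {P : Prog} {s : Store} (h : s.sets = []) : Runs (forSets P) s s 1 :=
  runs_forEach_nil h

/-- Transferring a word to `mask` reverses it, hence the reversals in `masks` and in the tests; `P`
runs when the end marker is met. -/
theorem runs_forSets_cons {P : Prog} {w : List Bool} {s s₁ s₂ : Store} {y : List Cell} {t₁ t₂ : ℕ}
    (h₁ : s.sets = w.map some ++ none :: y) (h₂ : s.mask = [])
    (hP : Runs P { s with sets := y, mask := w.reverse.map some } s₁ t₁)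
    (h : Runs (forSets P) s₁ s₂ t₂) : Runs (forSets P) s s₂ (2 * w.length + t₁ + t₂ + 1) := by
  have key : ∀ (w : List Bool) (s : Store), s.sets = w.map some ++ none :: y →
      Runs P { s with sets := y, mask := w.reverse.map some ++ s.mask } s₁ t₁ →
      Runs (forSets P) s s₂ (2 * w.length + t₁ + t₂ + 1) := by
    intro w
    induction w with
    | nil =>
      intro s hs hP
      exact Runs.cast (runs_forEach_cons hs hP h) rfl (by simp)
    | cons a w ih =>
      intro s hs hP
      refine Runs.cast (runs_forEach_cons hs (runs_push .mask (some a) _) (ih _ rfl ?_)) rfl ?_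
      · simpa [Store.set, Store.get] using hP
      · simp only [List.length_cons]
        omega
  exact key w s h₁ (by simpa [h₂] using hP)

/-- A bound on the running time of `expand` for `m` sets of vertices. -/
def expandTime (n m : ℕ) : ℕ := m * (7 * n * n + 14 * n + 3) + 2

theorem runs_expand {n : ℕ} {ws : List (List Bool)} {s : Store} (hn : ∀ w ∈ ws, w.length = n)
    (h₁ : s.sets = encodeWords ws) (h₂ : s.mask = []) (h₃ : s.pre = []) (h₄ : s.tmp = [])
    (h₅ : s.sets2 = []) :
    Runs expand s { s with sets := encodeWords (ws.flatMap fun w => setBits [] w.reverse) }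
      (expandTime n ws.length) := by
  have key : ∀ (ws : List (List Bool)) (s : Store), (∀ w ∈ ws, w.length = n) →
      s.sets = encodeWords ws → s.mask = [] → s.pre = [] → s.tmp = [] →
      Runs (forSets emitAll) s { s with
          sets := []
          sets2 := (encodeWords (ws.flatMap fun w => setBits [] w.reverse)).reverse ++ s.sets2 }
        (ws.length * (5 * n * n + 12 * n + 3) + 1) := by
    intro ws
    induction ws with
    | nil =>
      intro s hn h₁ h₂ h₃ h₄
      refine Runs.cast (runs_forSets_nil h₁) ?_ (by simp)
      cases s
      simp_all [encodeWords]
    | cons w ws ih =>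
      intro s hn h₁ h₂ h₃ h₄
      rw [encodeWords_cons] at h₁
      refine Runs.cast (runs_forSets_cons h₁ h₂
        (runs_emitAll (n := n) (w := w.reverse) (by simp [hn w List.mem_cons_self]) rfl h₃ h₄)
        (ih _ (fun v hv => hn v (List.mem_cons_of_mem w hv)) rfl rfl h₃ h₄)) ?_ ?_
      · simp [encodeWords, h₂]
      · simp only [hn w List.mem_cons_self, List.length_cons]
        ring_nf
        omega
  have hl : (encodeWords (ws.flatMap fun w => setBits [] w.reverse)).length =
      ws.length * n * (n + 1) := by
    rw [length_encodeWords (n := n), List.length_flatMap, List.map_congr_left (g := fun _ => n),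
      List.map_const', List.sum_replicate, smul_eq_mul]
    · intro w hw
      rw [length_setBits, List.length_reverse, hn w hw]
    · intro v hv
      obtain ⟨w, hw, hv⟩ := List.mem_flatMap.1 hv
      rw [length_of_mem_setBits hv, List.length_reverse, hn w hw, List.length_nil, zero_add]
  refine Runs.cast (Runs.seq (key ws s hn h₁ h₂ h₃ h₄) (runs_move (by decide) _)) ?_ ?_
  · cases s
    simp_all [Store.set, Store.get]
  · simp only [Store.get, h₅, List.append_nil, List.length_reverse, hl, expandTime]
    ring_nf
    omega

/-! ### The decision procedure: input, checks, search and answer. -/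

namespace Prog

/-- Put a token for every input symbol. -/
def makeTokens : Prog := (forEach .inp fun a => push .tok tick ;; push .tmp a) ;; move .tmp .inp

/-- Read a binary number and convert it to unary, as far as there are tokens for it. -/
def readNumber : Prog := (forWord .inp fun b => push .bits (some b)) ;; toUnary

/-- Move a unary number to `cnt` and restore its tokens. -/
def saveNumber : Prog := forEach .una fun _ => push .tok tick ;; push .cnt tick

/-- Read the number of vertices; prepare the set of all vertices and the empty set. -/
def readVertices : Prog :=
  push .room tick ;; push .sets none ;; forWord .inp fun b =>
    push .room tick ;; push .mask (some b) ;; push .sets (some false)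

/-- Put two ticks for every row on `lim`. -/
def countRows : Prog :=
  (forEach .inp fun a => push .tmp a ;;
    if a.isNone then push .lim tick ;; push .lim tick else skip) ;; move .tmp .inp

/-- Reduce `lim` by two ticks and `room` by one tick for every tick of `cnt`. -/
def useCount : Prog :=
  forEach .cnt fun _ => push .una tick ;; drop .lim ;; drop .lim ;; drop .room

/-- Read the input. -/
def readInput : Prog :=
  makeTokens ;; readNumber ;; saveNumber ;; readNumber ;; move .una .goal ;; readVertices ;;
  countRows ;; useCount

/-- Check that the set of all vertices induces enough classes and that there are enough
vertices. -/
def check : Prog :=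
  test ;; clear .mask ;; (popElim .ans (push .bad tick) fun _ => skip) ;;
  popElim .room (push .bad tick) fun _ => skip

/-- Generate the sets to be tested. -/
def makeSets : Prog := forEach .una fun _ => popElim .lim (drop .goal) fun _ => expand

/-- Test all sets. -/
def testSets : Prog := forSets (test ;; clear .mask)

/-- Leave a tick on `ans` for the answer yes, and nothing else. -/
def finish : Prog :=
  (popElim .bad skip fun _ => clear .bad ;; clear .ans) ;;
  (popElim .ans skip fun _ => clear .ans ;; push .ans tick) ;;
  clear .tok ;; clear .lim ;; clear .room ;; clear .goal ;; clear .inp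

/-- The decision procedure for Partial VC Dimension. -/
def partialVC : Prog := readInput ;; check ;; makeSets ;; testSets ;; finish

end Prog

theorem runs_makeTokens {s : Store} (h₁ : s.tok = []) (h₂ : s.tmp = []) :
    Runs makeTokens s { s with tok := ticks s.inp.length } (5 * s.inp.length + 2) := by
  have key : ∀ (y : List Cell) (s : Store) (c : ℕ), s.inp = y → s.tok = ticks c →
      Runs (forEach .inp fun a => push .tok tick ;; push .tmp a) s
        { s with inp := [], tok := ticks (c + y.length), tmp := y.reverse ++ s.tmp }
        (3 * y.length + 1) := by
    intro y
    induction y with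
    | nil =>
      intro s c h₁ h₂
      refine Runs.cast (runs_forEach_nil h₁) ?_ (by simp)
      cases s
      simp_all
    | cons a y ih =>
      intro s c h₁ h₂
      refine Runs.cast (runs_forEach_cons h₁ (Runs.seq (runs_push .tok tick _)
        (runs_push .tmp a _)) (ih _ (c + 1) rfl (congrArg (tick :: ·) h₂))) ?_ ?_
      · simp [Store.set, Store.get, Nat.add_assoc, Nat.add_comm 1]
      · simp only [List.length_cons]
        omega
  refine Runs.cast (Runs.seq (key _ s 0 rfl h₁) (runs_move (by decide) _)) ?_ ?_
  · cases s
    simp_all [Store.set, Store.get]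
  · simp [Store.get, h₂]
    omega

/-- The input has the least significant bit first; passing through `bits` reverses it, so that the
digits can be appended from the most significant one on. -/
theorem runs_readNumber {C k : ℕ} {s : Store} {y : List Cell}
    (h₁ : s.inp = k.bits.map some ++ none :: y) (h₂ : s.bits = []) (h₃ : s.una = [])
    (h₄ : s.tok = ticks C) (h₅ : s.tmp = []) :
    Runs readNumber s { s with
        inp := y
        una := ticks (min k C)
        tok := ticks (C - min k C) } (k.bits.length * (6 * C + 7) + 2) := by
  have key : ∀ (bs : List Bool) (s : Store), s.inp = bs.map some ++ none :: y →
      Runs (forWord .inp fun b => push .bits (some b)) s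
        { s with inp := y, bits := bs.reverse.map some ++ s.bits } (2 * bs.length + 1) := by
    intro bs
    induction bs with
    | nil =>
      intro s h
      exact Runs.cast (runs_forWord_nil h) (by simp [Store.set]) (by simp)
    | cons b bs ih =>
      intro s h
      refine Runs.cast (runs_forWord_cons h (runs_push .bits _ _) (ih _ rfl)) ?_ ?_
      · simp [Store.set, Store.get]
      · simp only [List.length_cons]
        omega
  refine Runs.cast (Runs.seq (key _ s h₁) (runs_toUnary C k.bits.reverse (v := 0) (Nat.zero_le _)
    (by simp [h₂]) h₃ h₄ h₅)) ?_ ?_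
  · rw [appendDigits_reverse_bits]
    cases s
    simp_all
  · simp only [List.length_reverse]
    ring_nf
    omega

/-- Giving the tokens back lets `l` be truncated at the full input length as well. -/
theorem runs_saveNumber (v : ℕ) : ∀ {s : Store} {c d : ℕ}, s.una = ticks v → s.tok = ticks c →
    s.cnt = ticks d →
    Runs saveNumber s { s with una := [], tok := ticks (c + v), cnt := ticks (d + v) }
      (3 * v + 1) := by
  induction v with
  | zero =>
    intro s c d h₁ h₂ h₃
    refine Runs.cast (runs_forEach_nil h₁) ?_ (by simp)
    cases s
    simp_all
  | succ v ih =>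
    intro s c d h₁ h₂ h₃
    refine Runs.cast (runs_forEach_cons h₁ (Runs.seq (runs_push .tok tick _)
      (runs_push .cnt tick _)) (ih (c := c + 1) (d := d + 1) rfl (congrArg (tick :: ·) h₂)
      (congrArg (tick :: ·) h₃))) ?_ (by omega)
    simp [Store.set, Store.get, Nat.add_assoc, Nat.add_comm 1]

/-- The extra tick on `room` matters: after subtracting `k` from `n + 1`, the stack is nonempty
exactly if `k ≤ n`. -/
theorem runs_readVertices {n : ℕ} {s : Store} {y : List Cell}
    (h₁ : s.inp = (List.replicate n true).map some ++ none :: y) (h₂ : s.room = [])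
    (h₃ : s.sets = []) (h₄ : s.mask = []) :
    Runs readVertices s { s with
        inp := y
        room := ticks (n + 1)
        mask := (List.replicate n true).map some
        sets := encodeWords (masks n 0) } (4 * n + 3) := by
  have key : ∀ (n : ℕ) (s : Store) (c d : ℕ),
      s.inp = (List.replicate n true).map some ++ none :: y → s.room = ticks c →
      s.mask = ticks d →
      Runs (forWord .inp fun b =>
        push .room tick ;; push .mask (some b) ;; push .sets (some false)) s { s with
          inp := y
          room := ticks (c + n)
          mask := ticks (d + n)
          sets := List.replicate n (some false) ++ s.sets } (4 * n + 1) := by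
    intro n
    induction n with
    | zero =>
      intro s c d h₁ h₂ h₃
      refine Runs.cast (runs_forWord_nil h₁) ?_ (by simp)
      cases s
      simp_all [Store.set]
    | succ n ih =>
      intro s c d h₁ h₂ h₃
      refine Runs.cast (runs_forWord_cons h₁ (Runs.seq (runs_push .room tick _)
        (Runs.seq (runs_push .mask _ _) (runs_push .sets _ _)))
        (ih _ (c + 1) (d + 1) rfl (congrArg (tick :: ·) h₂) (congrArg (tick :: ·) h₃))) ?_ (by omega)
      simp [Store.set, Store.get, Nat.add_assoc, Nat.add_comm 1, List.replicate_succ',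
        List.append_assoc]
  refine Runs.cast (Runs.seq (runs_push .room tick _) (Runs.seq (runs_push .sets none _)
    (key n _ 1 0 h₁ (congrArg (tick :: ·) h₂) h₄))) ?_ (by omega)
  simp [Store.set, Store.get, h₃, masks, encodeWords, ticks, tick, Nat.add_comm 1]

theorem count_none_encodeWords (ws : List (List Bool)) :
    (encodeWords ws).count none = ws.length := by
  induction ws with
  | nil => rfl
  | cons w ws ih =>
    rw [encodeWords_cons, List.count_append, List.count_cons_self, ih, List.length_cons,
      List.count_eq_zero.2 (by simp), zero_add]

theorem runs_countRows {s : Store} {ds : List (List Bool)} (h₁ : s.inp = encodeWords ds)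
    (h₂ : s.lim = []) (h₃ : s.tmp = []) :
    Runs countRows s { s with lim := ticks (2 * ds.length) } (6 * s.inp.length + 2) := by
  have key : ∀ (y : List Cell) (s : Store) (c : ℕ), s.inp = y → s.lim = ticks c →
      Runs (forEach .inp fun a => push .tmp a ;;
        if a.isNone then push .lim tick ;; push .lim tick else skip) s
        { s with inp := [], lim := ticks (c + 2 * y.count none), tmp := y.reverse ++ s.tmp }
        (4 * y.length + 1) := by
    intro y
    induction y with
    | nil =>
      intro s c h₁ h₂
      refine Runs.cast (runs_forEach_nil h₁) ?_ (by simp)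
      cases s
      simp_all
    | cons a y ih =>
      intro s c h₁ h₂
      cases a with
      | none =>
        refine Runs.cast (runs_forEach_cons h₁ (Runs.seq (runs_push .tmp _ _)
          (Runs.seq (runs_push .lim tick _) (runs_push .lim tick _)))
          (ih _ (c + 2) rfl (congrArg (tick :: tick :: ·) h₂))) ?_ ?_
        · simp only [Store.set, Store.get, List.count_cons_self, List.reverse_cons,
            List.append_assoc, List.singleton_append, Store.mk.injEq, true_and, and_true]
          exact congrArg ticks (by omega)
        · simp only [List.length_cons]
          omega
      | some b =>
        refine Runs.cast (runs_forEach_cons h₁ (Runs.seq (runs_push .tmp _ _)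
          (runs_skip _)) (ih _ c rfl h₂)) ?_ ?_
        · simp [Store.set, Store.get]
        · simp only [List.length_cons]
          omega
  refine Runs.cast (Runs.seq (key _ s 0 rfl h₂) (runs_move (by decide) _)) ?_ ?_
  · have := count_none_encodeWords ds
    cases s
    simp_all [Store.set, Store.get]
  · simp [Store.get, h₃]
    omega

theorem runs_useCount (v : ℕ) : ∀ {s : Store} {a b c : ℕ}, s.cnt = ticks v → s.una = ticks a →
    s.lim = ticks b → s.room = ticks c →
    Runs useCount s { s with
        cnt := []
        una := ticks (a + v)
        lim := ticks (b - 2 * v)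
        room := ticks (c - v) } (8 * v + 1) := by
  induction v with
  | zero =>
    intro s a b c h₁ h₂ h₃ h₄
    refine Runs.cast (runs_forEach_nil h₁) ?_ (by simp)
    cases s
    simp_all
  | succ v ih =>
    intro s a b c h₁ h₂ h₃ h₄
    refine Runs.cast (runs_forEach_cons h₁ (Runs.seq (runs_push .una tick _)
      (Runs.seq (runs_drop .lim _) (Runs.seq (runs_drop .lim _) (runs_drop .room _))))
      (ih (a := a + 1) (b := b - 2) (c := c - 1) rfl (congrArg (tick :: ·) h₂)
        (by simp [Store.set, Store.get, h₃, Nat.sub_sub])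
        (by simp [Store.set, Store.get, h₄]))) ?_ (by omega)
    simp only [Store.set, Store.mk.injEq, true_and, and_true]
    exact ⟨congrArg ticks (by omega), congrArg ticks (by omega), congrArg ticks (by omega)⟩

theorem runs_readInput {k l n z : ℕ} {ds : List (List Bool)} {s : Store}
    (hs : s = { inp := encodeWords (k.bits :: l.bits :: List.replicate n true :: ds) })
    (hz : s.inp.length = z) :
    Runs readInput s {
        inp := encodeWords ds
        tok := ticks (z - min l z)
        una := ticks (min k z)
        lim := ticks (2 * ds.length - 2 * min k z)
        room := ticks (n + 1 - min k z)
        goal := ticks (min l z)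
        mask := (List.replicate n true).map some
        sets := encodeWords (masks n 0) } (12 * z * z + 42 * z + 14) := by
  have hz' := hz
  simp only [hs, encodeWords_cons, List.length_append, List.length_cons, List.length_map,
    List.length_replicate] at hz'
  subst hs
  have hk : (k.bits).length * (6 * z + 7) ≤ z * (6 * z + 7) := Nat.mul_le_mul_right _ (by omega)
  have hl : (l.bits).length * (6 * z + 7) ≤ z * (6 * z + 7) := Nat.mul_le_mul_right _ (by omega)
  simp only [encodeWords_cons] at hz ⊢
  refine Runs.cast (Runs.seq (runs_makeTokens rfl rfl) (Runs.seq
    (runs_readNumber rfl rfl rfl (congrArg ticks hz) rfl) (Runs.seq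
    (runs_saveNumber (min k z) (c := z - min k z) (d := 0) rfl rfl rfl) (Runs.seq
    (runs_readNumber (C := z) rfl rfl rfl (congrArg ticks (by omega)) rfl) (Runs.seq
    (runs_move (by decide) _) (Runs.seq
    (runs_readVertices (n := n) (y := encodeWords ds) rfl rfl rfl rfl) (Runs.seq
    (runs_countRows (ds := ds) rfl rfl rfl)
    (runs_useCount (min k z) (a := 0) (b := 2 * ds.length) (c := n + 1)
      (congrArg ticks (by omega)) rfl rfl rfl)))))))) ?_ ?_
  · simp [Store.set, Store.get]
  · simp only [Store.get, length_ticks, hz]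
    ring_nf at hk hl ⊢
    omega

theorem runs_check {n k g : ℕ} {ds : List (List Bool)} {s : Store} {m : List Bool}
    (hm : m.length = n) (hlen : ∀ d ∈ ds, d.length = n) (hs : s.Clean) (h₁ : s.inp = encodeWords ds)
    (h₂ : s.mask = m.map some) (h₃ : s.goal = ticks g) (h₄ : s.ans = []) (h₅ : s.bad = [])
    (h₆ : s.room = ticks (n + 1 - k)) :
    Runs check s { s with
        mask := []
        room := ticks (n - k)
        bad := ticks ((if g ≤ classCount m ds then 0 else 1) + if k ≤ n then 0 else 1) }
      (testTime n ds.length g + 2 * n + 5) := by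
  have hans : Runs (popElim .ans (push .bad tick) fun _ => skip)
      { s with mask := [], ans := if g ≤ classCount m ds then tick :: s.ans else s.ans }
      { s with mask := [], bad := ticks (if g ≤ classCount m ds then 0 else 1) } 2 := by
    split_ifs with h
    · refine Runs.cast (runs_popElim_cons rfl (runs_skip _)) ?_ le_rfl
      cases s
      simp_all [Store.set]
    · refine Runs.cast (runs_popElim_nil h₄ (runs_push .bad tick _)) ?_ le_rfl
      simp [Store.set, Store.get, h₅, ticks]
  have hroom : Runs (popElim .room (push .bad tick) fun _ => skip)
      { s with mask := [], bad := ticks (if g ≤ classCount m ds then 0 else 1) }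
      { s with
        mask := []
        room := ticks (n - k)
        bad := ticks ((if g ≤ classCount m ds then 0 else 1) + if k ≤ n then 0 else 1) } 2 := by
    rcases Nat.lt_or_ge n k with h | h
    · refine Runs.cast (runs_popElim_nil ?_ (runs_push .bad tick _)) ?_ le_rfl
      · simp only [Store.get, h₆, Nat.sub_eq_zero_of_le h, ticks_zero]
      · have e : n + 1 - k = n - k := by omega
        rw [if_neg (not_le.2 h)]
        simp only [Store.set, Store.get, tick_cons_ticks, h₆, e]
    · have e : n + 1 - k = n - k + 1 := by omega
      refine Runs.cast (runs_popElim_cons (a := tick) (y := ticks (n - k)) ?_ (runs_skip _)) ?_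
        le_rfl
      · simp only [Store.get, h₆, e, ticks_succ]
      · rw [if_pos h]
        rfl
  refine Runs.cast (Runs.seq (runs_test hm hlen hs h₁ h₂ h₃) (Runs.seq (runs_clear .mask _)
    (Runs.seq hans hroom))) rfl ?_
  simp only [Store.get, h₂, List.length_map, hm]
  omega

theorem expandTime_mono (n : ℕ) {m m' : ℕ} (h : m ≤ m') : expandTime n m ≤ expandTime n m' :=
  Nat.add_le_add_right (Nat.mul_le_mul_right _ h) 2

/-- Each of the `a` vertices to be chosen is either enumerated, while `lim` lasts, or left to the
greedy growth, which is credited with one class by lowering the goal. `R` keeps the bound on the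
number of sets fixed during the induction. -/
theorem runs_makeSets {n R : ℕ} (a : ℕ) : ∀ {s : Store} {i b g : ℕ}, i + min a b ≤ R →
    s.una = ticks a → s.lim = ticks b → s.goal = ticks g → s.sets = encodeWords (masks n i) →
    s.mask = [] → s.pre = [] → s.tmp = [] → s.sets2 = [] →
    Runs makeSets s { s with
        una := []
        lim := ticks (b - a)
        goal := ticks (g - (a - b))
        sets := encodeWords (masks n (i + min a b)) }
      (a * (expandTime n ((n + 1) ^ R) + 4) + 1) := by
  induction a with
  | zero =>
    intro s i b g _ h₁ h₂ h₃ h₄ _ _ _ _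
    refine Runs.cast (runs_forEach_nil h₁) ?_ (by simp)
    cases s
    simp_all
  | succ a ih =>
    intro s i b g hR h₁ h₂ h₃ h₄ h₅ h₆ h₇ h₈
    cases b with
    | zero =>
      refine Runs.cast (runs_forEach_cons h₁ (runs_popElim_nil h₂ (runs_drop .goal _))
        (ih (i := i) (b := 0) (g := g - 1) (by omega) rfl h₂ (by simp [Store.set, Store.get, h₃])
          h₄ h₅ h₆ h₇ h₈)) ?_ ?_
      · simp only [Store.set, Nat.min_zero, Nat.zero_sub, Store.mk.injEq, true_and, and_true]
        exact congrArg ticks (by omega)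
      · ring_nf
        omega
    | succ b =>
      have hle : n ^ i ≤ (n + 1) ^ R :=
        (Nat.pow_le_pow_left (Nat.le_succ n) i).trans
          (Nat.pow_le_pow_right (Nat.succ_pos n) (by omega))
      have ht := expandTime_mono n hle
      refine Runs.cast (runs_forEach_cons h₁ (runs_popElim_cons h₂ (runs_expand (n := n)
        (fun w hw => length_of_mem_masks hw) h₄ h₅ h₆ h₇ h₈))
        (ih (i := i + 1) (b := b) (g := g) (by omega) rfl rfl h₃ rfl h₅ h₆ h₇ h₈)) ?_ ?_
      · have e : i + 1 + min a b = i + min (a + 1) (b + 1) := by omega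
        simp only [Store.set, e, Nat.add_sub_add_right]
      · rw [length_masks, Nat.succ_mul]
        omega

theorem runs_testSets {n g : ℕ} {ds : List (List Bool)} (hlen : ∀ d ∈ ds, d.length = n)
    (ws : List (List Bool)) : ∀ {s : Store} {c : ℕ}, (∀ w ∈ ws, w.length = n) → s.Clean →
    s.inp = encodeWords ds → s.goal = ticks g → s.sets = encodeWords ws → s.mask = [] →
    s.ans = ticks c →
    Runs testSets s { s with
        sets := []
        ans := ticks (c + ws.countP fun w => g ≤ classCount w.reverse ds) }
      (ws.length * (testTime n ds.length g + 4 * n + 2) + 1) := by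
  induction ws with
  | nil =>
    intro s c _ _ _ _ h₄ _ h₆
    refine Runs.cast (runs_forSets_nil h₄) ?_ (by simp)
    cases s
    simp_all [encodeWords]
  | cons w ws ih =>
    intro s c hn hs h₁ h₃ h₄ h₅ h₆
    rw [encodeWords_cons] at h₄
    have hw := hn w List.mem_cons_self
    have hc : (if g ≤ classCount w.reverse ds then tick :: s.ans else s.ans) =
        ticks (c + if g ≤ classCount w.reverse ds then 1 else 0) := by
      rw [h₆]
      split_ifs <;> rfl
    refine Runs.cast (runs_forSets_cons h₄ h₅ (Runs.seq
      (runs_test (n := n) (m := w.reverse) (by simp [hw]) hlen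
        ⟨hs.1, hs.2, hs.3, hs.4, hs.5, hs.6, hs.7⟩ h₁ rfl h₃) (runs_clear .mask _))
      (ih (fun v hv => hn v (List.mem_cons_of_mem w hv))
        ⟨hs.1, hs.2, hs.3, hs.4, hs.5, hs.6, hs.7⟩ h₁ h₃ rfl rfl hc)) ?_ ?_
    · simp only [Store.set, List.countP_cons, decide_eq_true_eq, h₅, Store.mk.injEq, true_and,
        and_true]
      exact congrArg ticks (by omega)
    · simp only [Store.get, List.length_map, List.length_reverse, hw, List.length_cons,
        Nat.succ_mul]
      omega

/-- The final configuration must have nothing but the output, so every stack still in use is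
emptied. -/
theorem runs_finish {a b : ℕ} {s : Store} (h₁ : s.bad = ticks b) (h₂ : s.ans = ticks a) :
    Runs finish s { s with
        tok := []
        lim := []
        room := []
        goal := []
        inp := []
        bad := []
        ans := if b = 0 ∧ a ≠ 0 then [tick] else [] }
      (2 * (b + 2 * a + s.tok.length + s.lim.length + s.room.length + s.goal.length + s.inp.length)
        + 14) := by
  have hbad : Runs (popElim .bad skip fun _ => clear .bad ;; clear .ans) s
      { s with bad := [], ans := ticks (if b = 0 then a else 0) } (2 * (b + a) + 3) := by
    cases b with
    | zero =>
      refine Runs.cast (runs_popElim_nil h₁ (runs_skip _)) ?_ (by omega)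
      cases s
      simp_all
    | succ b =>
      refine Runs.cast (runs_popElim_cons h₁ (Runs.seq (runs_clear .bad _) (runs_clear .ans _)))
        ?_ ?_
      · simp [Store.set]
      · simp only [Store.set, Store.get, List.length_replicate, h₂, length_ticks]
        omega
  have hans : Runs (popElim .ans skip fun _ => clear .ans ;; push .ans tick)
      { s with bad := [], ans := ticks (if b = 0 then a else 0) }
      { s with bad := [], ans := if b = 0 ∧ a ≠ 0 then [tick] else [] } (2 * a + 3) := by
    by_cases hb : b = 0
    · cases a with
      | zero =>
        refine Runs.cast (runs_popElim_nil ?_ (runs_skip _)) ?_ (by omega) <;> simp [Store.get]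
      | succ a =>
        refine Runs.cast (runs_popElim_cons (a := tick) (y := ticks a)
          (by simp [Store.get, hb, ticks_succ])
          (Runs.seq (runs_clear .ans _) (runs_push .ans tick _))) ?_ ?_
        · simp [Store.set, Store.get, hb]
        · simp only [Store.set, Store.get, length_ticks]
          omega
    · refine Runs.cast (runs_popElim_nil ?_ (runs_skip _)) ?_ (by omega) <;>
        simp [Store.get, hb]
  refine Runs.cast (Runs.seq hbad (Runs.seq hans (Runs.seq (runs_clear .tok _)
    (Runs.seq (runs_clear .lim _) (Runs.seq (runs_clear .room _) (Runs.seq (runs_clear .goal _)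
    (runs_clear .inp _))))))) rfl ?_
  simp only [Store.set, Store.get]
  omega

/-- A bound on the running time of the decision procedure on inputs of length `z` for which sets
of up to `r` vertices are tested. -/
def partialVCTime (z r : ℕ) : ℕ :=
  12 * z * z + 42 * z + 14 + (testTime z z z + 2 * z + 5) +
    (z * (expandTime z ((z + 1) ^ r) + 4) + 1) +
    ((z + 1) ^ r * (testTime z z z + 4 * z + 2) + 1) + (2 * (2 * (z + 1) ^ r + 6 * z + 3) + 14)

theorem testTime_mono {n n' m m' g g' : ℕ} (hn : n ≤ n') (hm : m ≤ m') (hg : g ≤ g') :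
    testTime n m g ≤ testTime n' m' g' := by
  unfold testTime
  gcongr

/-- The left side of `hQ` is what the procedure actually checks; its equivalence with the problem is
left to `accepts_iff`. -/
theorem runs_partialVC {k l n z : ℕ} {ds : List (List Bool)} {s : Store} {Q : Prop} [Decidable Q]
    (hlen : ∀ d ∈ ds, d.length = n)
    (hs : s = { inp := encodeWords (k.bits :: l.bits :: List.replicate n true :: ds) })
    (hz : s.inp.length = z)
    (hQ : (min l z ≤ classCount (List.replicate n true) ds ∧ min k z ≤ n) ∧
      (∃ w ∈ masks n (min (min k z) (2 * ds.length - 2 * min k z)),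
        min l z - (min k z - (2 * ds.length - 2 * min k z)) ≤ classCount w.reverse ds) ↔ Q) :
    Runs partialVC s { ans := if Q then [tick] else [] }
      (partialVCTime z (min (min k z) (2 * ds.length - 2 * min k z))) := by
  have hread := runs_readInput hs hz
  have hz' := hz
  simp only [hs, encodeWords_cons, List.length_append, List.length_cons, List.length_map,
    List.length_replicate] at hz'
  have hE := length_encodeWords hlen
  have hn : n ≤ z := by omega
  have hm : ds.length ≤ z := by
    have : ds.length * 1 ≤ ds.length * (n + 1) := Nat.mul_le_mul_left _ (by omega)
    omega
  set K := min k z with hK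
  set G := min l z with hG
  set M := 2 * ds.length - 2 * K with hM
  have hKz : K ≤ z := min_le_right _ _
  have hGz : G ≤ z := min_le_right _ _
  clear_value K G
  have hcheck := runs_check (n := n) (k := K) (g := G) (ds := ds)
    (m := List.replicate n true)
    (s := {
      inp := encodeWords ds
      tok := ticks (z - G)
      una := ticks K
      lim := ticks M
      room := ticks (n + 1 - K)
      goal := ticks G
      mask := (List.replicate n true).map some
      sets := encodeWords (masks n 0) })
    (by simp) hlen ⟨rfl, rfl, rfl, rfl, rfl, rfl, rfl⟩ rfl rfl rfl rfl rfl rfl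
  refine Runs.cast (Runs.seq hread (Runs.seq hcheck (Runs.seq
    (runs_makeSets (n := n) (R := min K M) K (i := 0) (b := M) (g := G) (by omega)
      rfl rfl rfl rfl rfl rfl rfl rfl) (Runs.seq
    (runs_testSets hlen (masks n (0 + min K M)) (g := G - (K - M)) (c := 0)
      (fun w hw => length_of_mem_masks hw) ⟨rfl, rfl, rfl, rfl, rfl, rfl, rfl⟩ rfl rfl rfl rfl rfl)
    (runs_finish (b := (if G ≤ classCount (List.replicate n true) ds then 0 else 1) +
      if K ≤ n then 0 else 1) rfl rfl))))) ?_ ?_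
  · simp only [Store.mk.injEq, true_and, and_true]
    refine if_congr (Iff.trans ?_ hQ) rfl rfl
    refine and_congr ?_ ?_
    · split_ifs <;> simp_all
    · rw [zero_add, zero_add, ← Nat.pos_iff_ne_zero, List.countP_pos_iff]
      simp
  · have hpow : n ^ min K M ≤ (z + 1) ^ min K M := Nat.pow_le_pow_left (by omega) _
    have hpow' : (n + 1) ^ min K M ≤ (z + 1) ^ min K M := Nat.pow_le_pow_left (by omega) _
    have hcount : (masks n (0 + min K M)).countP
        (fun w => decide (G - (K - M) ≤ classCount w.reverse ds)) ≤ (z + 1) ^ min K M := by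
      refine List.countP_le_length.trans ?_
      rw [length_masks, zero_add]
      exact hpow
    have t₁ := testTime_mono hn hm hGz
    have t₂ := testTime_mono hn hm ((Nat.sub_le G (K - M)).trans hGz)
    have t₃ : K * (expandTime n ((n + 1) ^ min K M) + 4) ≤
        z * (expandTime z ((z + 1) ^ min K M) + 4) := by
      unfold expandTime
      gcongr
    have t₄ : (masks n (0 + min K M)).length * (testTime n ds.length (G - (K - M)) + 4 * n + 2) ≤
        (z + 1) ^ min K M * (testTime z z z + 4 * z + 2) := by
      rw [length_masks, zero_add]
      gcongr
    have t₅ : ((if G ≤ classCount (List.replicate n true) ds then 0 else 1) +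
        if K ≤ n then 0 else 1) ≤ 2 := by
      split_ifs <;> simp
    simp only [length_ticks, partialVCTime]
    omega

/-! ### Words as vertex sets, and correctness of the acceptance condition. -/

/-- The characteristic word of a set of vertices. -/
def charWord {n : ℕ} (C : Finset (Fin n)) : List Bool := List.ofFn fun x => decide (x ∈ C)

@[simp] theorem length_charWord {n : ℕ} (C : Finset (Fin n)) : (charWord C).length = n :=
  List.length_ofFn

theorem charWord_injective (n : ℕ) : Function.Injective (charWord (n := n)) := by
  intro C D h
  ext x
  simpa using congrFun (List.ofFn_injective h) x

theorem exists_charWord {n : ℕ} {w : List Bool} (h : w.length = n) :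
    ∃ C : Finset (Fin n), charWord C = w := by
  subst h
  refine ⟨Finset.univ.filter fun x => w.get x = true, ?_⟩
  simp [charWord]

theorem charWord_univ (n : ℕ) : charWord (Finset.univ : Finset (Fin n)) = List.replicate n true := by
  simp [charWord]

theorem zipWith_charWord {n : ℕ} (C D : Finset (Fin n)) :
    List.zipWith and (charWord C) (charWord D) = charWord (D ∩ C) := by
  refine List.ext_getElem (by simp) fun i _ _ => ?_
  simp [charWord, and_comm]

theorem count_charWord {n : ℕ} (C : Finset (Fin n)) : (charWord C).count true = C.card := by
  rw [charWord, List.ofFn_eq_map, List.count, List.countP_map]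
  have : C = Finset.univ.filter (· ∈ C) := by simp
  conv_rhs => rw [this]
  rw [Finset.card_def, Finset.filter_val, ← Multiset.countP_eq_card_filter]
  refine Eq.trans ?_ (Multiset.coe_countP _ _).symm
  refine List.countP_congr fun x _ => ?_
  simp

/-- The rows of the incidence matrix. -/
def FinHypergraph.rows (H : FinHypergraph) : List (List Bool) :=
  (List.finRange H.numEdges).map H.row

theorem FinHypergraph.length_of_mem_rows (H : FinHypergraph) :
    ∀ d ∈ H.rows, d.length = H.numVertices := by
  intro d hd
  obtain ⟨i, -, rfl⟩ := List.mem_map.1 hd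
  exact length_charWord _

theorem FinHypergraph.classCount_rows (H : FinHypergraph) (C : Finset (Fin H.numVertices)) :
    classCount (charWord C) H.rows = H.numClasses C := by
  have : (H.rows.map (List.zipWith and (charWord C))).toFinset =
      (Finset.univ.image fun i => H.edge i ∩ C).image charWord := by
    ext w
    simp only [rows, List.map_map, List.mem_toFinset, List.mem_map, List.mem_finRange, true_and,
      Function.comp_apply, Finset.mem_image, Finset.mem_univ, exists_exists_eq_and]
    refine exists_congr fun i => ?_
    rw [← zipWith_charWord]
    rfl
  rw [classCount, this, Finset.card_image_of_injective _ (charWord_injective _)]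
  rfl

/-- Truncation at `z` is invisible: the checks compare `k` with the number of vertices and `l` with
a class count of at most `|E|`, and both bounds are below `z`. A truncated value fails just as the
original does. -/
theorem PartialVCInstance.accepts_iff (I : PartialVCInstance) {z : ℕ}
    (hz : I.H.numVertices + I.H.numEdges < z) :
    (min I.l z ≤ classCount (List.replicate I.H.numVertices true) I.H.rows ∧
        min I.k z ≤ I.H.numVertices) ∧
      (∃ w ∈ masks I.H.numVertices (min (min I.k z) (2 * I.H.rows.length - 2 * min I.k z)),
        min I.l z - (min I.k z - (2 * I.H.rows.length - 2 * min I.k z)) ≤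
          classCount w.reverse I.H.rows) ↔ I.IsYes := by
  have hrows : I.H.rows.length = I.H.numEdges := by simp [FinHypergraph.rows]
  have hle := I.H.numClasses_le Finset.univ
  rw [hrows, ← charWord_univ, FinHypergraph.classCount_rows]
  constructor
  · rintro ⟨⟨hl, hk⟩, w, hw, hwl⟩
    obtain ⟨C, hC⟩ := exists_charWord ((List.length_reverse).trans (length_of_mem_masks hw))
    have hcard := count_le_of_mem_masks hw
    rw [← List.count_reverse, ← hC, count_charWord] at hcard
    rw [← hC, FinHypergraph.classCount_rows] at hwl
    exact I.isYes_of_small (by omega) (by omega) C (by omega) (by omega)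
  · intro h
    obtain ⟨hk, hl, D, hD, hDl⟩ := I.isYes_iff.1 h
    refine ⟨⟨by omega, by omega⟩, (charWord D).reverse, mem_masks (by simp) ?_, ?_⟩
    · rw [List.count_reverse, count_charWord, hD]
      omega
    · rw [List.reverse_reverse, FinHypergraph.classCount_rows]
      omega

/-! ### The Turing machine and its running time. -/

/-- The Turing machine that runs the decision procedure and writes the answer on the output
stack. -/
def partialVCMachine : Turing.FinTM2 where
  K := Option Reg
  k₀ := some .inp
  k₁ := none
  Γ := StackAlphabet
  Λ := Option partialVC.Label
  main := some partialVC.entry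
  σ := Option Cell
  initialState := none
  Γk₀Fin := inferInstanceAs (Fintype Cell)
  m := fun l => l.elim
    (.pop (some .ans) (fun _ o => o) (.push none (fun o => o.isSome) (.load (fun _ => none) .halt)))
    fun l => partialVC.code some none l

theorem initList_partialVCMachine (y : List Cell) :
    Turing.initList partialVCMachine y =
      ⟨some (some partialVC.entry), none, Store.stackMap { inp := y }⟩ := by
  unfold Turing.initList
  congr 1
  funext k
  rcases k with _ | r
  · rfl
  · cases r <;> rfl

theorem haltList_partialVCMachine (b : Bool) :
    Turing.haltList partialVCMachine [b] =
      ⟨none, none, Function.update (Store.stackMap {}) none [b]⟩ := by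
  unfold Turing.haltList
  congr 1
  funext k
  rcases k with _ | r
  · rfl
  · cases r <;> rfl

/-- The additional step is that of the label `none`, which turns the content of `ans` into the
output bit, resets the state and halts. -/
theorem partialVCMachine_outputs {y : List Cell} {b : Bool} {t : ℕ}
    (h : Runs partialVC { inp := y } { ans := if b then [tick] else [] } t) :
    Nonempty (Turing.TM2OutputsInTime partialVCMachine y (some [b]) (t + 1)) := by
  obtain ⟨v, n, hn, e⟩ := h _ partialVCMachine.m some none (fun _ => rfl) none
  suffices h : (flip bind partialVCMachine.step)^[1 + n]
      (some (Turing.initList partialVCMachine y)) =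
        (some [b]).map (Turing.haltList partialVCMachine) from
    ⟨⟨⟨1 + n, h⟩, (Nat.add_comm 1 n).trans_le (Nat.succ_le_succ hn)⟩⟩
  rw [initList_partialVCMachine]
  refine (iterStep_add e).trans ?_
  refine (iterStep_one rfl v _).trans ?_
  refine Eq.trans ?_ (congrArg some (haltList_partialVCMachine b)).symm
  cases b
  all_goals
    refine congrArg (fun S => some (Turing.TM2.Cfg.mk none none S)) ?_
    funext k
    rcases k with _ | r
    · rfl
    · cases r <;> rfl

/-- From `z + 1 ≤ z ^ 2` the number of sets is at most `z ^ (4 * p)`. The remaining factor is cubic,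
and its constant is absorbed by `3 ^ 6 = 729 ≤ z ^ 6`, whence the exponent `4 * p + 3 + 6`. -/
theorem partialVCTime_lt {z r p : ℕ} (hz : 3 ≤ z) (hr : r ≤ 2 * p) :
    partialVCTime z r + 1 ≤ z ^ (4 * p + 9) := by
  have hW : (z + 1) ^ r ≤ z ^ (4 * p) := by
    calc (z + 1) ^ r ≤ (z ^ 2) ^ r := Nat.pow_le_pow_left (by nlinarith) r
      _ ≤ (z ^ 2) ^ (2 * p) := Nat.pow_le_pow_right (by positivity) hr
      _ = z ^ (4 * p) := by rw [← pow_mul]; ring_nf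
  have h₁ : 1 ≤ z ^ (4 * p) := Nat.one_le_pow _ _ (by omega)
  have h₂ : partialVCTime z r ≤ 500 * z ^ 3 * z ^ (4 * p) := by
    generalize z ^ (4 * p) = W at hW h₁
    have e₀ : 1 ≤ z ^ 3 := Nat.one_le_pow _ _ (by omega)
    have e₁ : z ≤ z ^ 3 := Nat.le_self_pow (by norm_num) z
    have e₂ : z * z ≤ z ^ 3 := by
      rw [← sq]
      exact Nat.pow_le_pow_right (by omega) (by norm_num)
    have ht : testTime z z z ≤ 49 * z ^ 3 := by
      unfold testTime
      ring_nf at e₂ ⊢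
      omega
    have hx : z * (expandTime z ((z + 1) ^ r) + 4) ≤ 24 * (W * z ^ 3) + 6 * z := by
      have : (z + 1) ^ r * (7 * z * z + 14 * z + 3) * z ≤ W * (24 * z ^ 3) := by
        rw [mul_assoc]
        refine Nat.mul_le_mul hW ?_
        ring_nf at e₂ ⊢
        omega
      unfold expandTime
      linarith
    have hy : (z + 1) ^ r * (testTime z z z + 4 * z + 2) ≤ W * (55 * z ^ 3) :=
      Nat.mul_le_mul hW (by omega)
    have hc : z ^ 3 ≤ W * z ^ 3 := Nat.le_mul_of_pos_left _ h₁
    have hw : W ≤ W * z ^ 3 := Nat.le_mul_of_pos_right _ e₀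
    unfold partialVCTime
    linarith
  have h₃ : 729 ≤ z ^ 6 := Nat.pow_le_pow_left hz 6
  have h₄ : 1 ≤ z ^ 3 * z ^ (4 * p) := Nat.mul_pos (by positivity) h₁
  calc partialVCTime z r + 1 ≤ 729 * (z ^ 3 * z ^ (4 * p)) := by linarith
    _ ≤ z ^ 6 * (z ^ 3 * z ^ (4 * p)) := Nat.mul_le_mul_right _ h₃
    _ = z ^ (4 * p + 9) := by ring

theorem mainTheorem12 : partialVCDimensionDual.InXP := by
  refine ⟨fun p => 4 * p + 9, ⟨partialVCMachine, Equiv.refl _, Equiv.refl _⟩, ?_, ?_, ?_⟩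
  · exact (Primrec.nat_add.comp (Primrec.nat_mul.comp (Primrec.const 4) Primrec.id)
      (Primrec.const 9)).to_comp
  · rintro (_ | r)
    · exact inferInstanceAs (Finite Bool)
    · exact inferInstanceAs (Finite Cell)
  · intro (I : PartialVCInstance)
    have hencode : I.encode = encodeWords
        (I.k.bits :: I.l.bits :: List.replicate I.H.numVertices true :: I.H.rows) := rfl
    have hlen : I.encode.length = I.k.bits.length + (I.l.bits.length +
        (I.H.numVertices + I.H.numEdges * (I.H.numVertices + 1) + 1) + 1) + 1 := by
      have : I.H.rows.length = I.H.numEdges := by simp [FinHypergraph.rows]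
      simp [hencode, encodeWords_cons, length_encodeWords I.H.length_of_mem_rows, this]
      ring
    have hm : I.H.numEdges ≤ I.H.numEdges * (I.H.numVertices + 1) :=
      Nat.le_mul_of_pos_right _ (Nat.succ_pos _)
    -- If truncation changes `k`, then `k` exceeds the input length and so `|E|`, and both sides are
    -- `0`.
    have hr : min (min I.k I.encode.length)
        (2 * I.H.rows.length - 2 * min I.k I.encode.length) ≤ 2 * (I.H.numEdges - I.k) := by
      have : I.H.rows.length = I.H.numEdges := by simp [FinHypergraph.rows]
      omega
    classical
    obtain ⟨o⟩ := partialVCMachine_outputs (b := decide I.IsYes)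
      (runs_partialVC (s := { inp := I.encode }) I.H.length_of_mem_rows (by rw [hencode]) rfl
        ((I.accepts_iff (by simp only; omega)).trans (by simp)))
    -- The length is at least `3` because of the end markers of the first three words.
    have hle := o.steps_le_m.trans (partialVCTime_lt (by simp only; omega) hr)
    have key : ∀ y : List Cell, y = I.encode → Nonempty (Turing.TM2OutputsInTime partialVCMachine y
        (some [decide I.IsYes]) (I.encode.length ^ (4 * (I.H.numEdges - I.k) + 9))) := by
      rintro y rfl
      exact ⟨⟨o.toEvalsTo, hle⟩⟩
    exact key _ (List.map_id' _)
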